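/- **Setting.** Let $d\ge 1$ and let $K=K_1\times K_2\subset\mathbb R^d$, where $K_1\subset\mathbb R$ is a nondegenerate, possibly unbounded, closed interval with $0\in K_1^\circ$ and $K_2\subset\mathbb R^{d-1}$ is a product of $d-1$ nondegenerate, possibly unbounded, closed intervals (a single point if $d=1$). For a closed rectangle $T$ let $\mathcal D_T$ be the set of functions $f:T\to\mathbb R$ such that, at every $x\in T$, the limit of $f$ along each of the $2^d$ open quadrants of $T$ with vertex $x$ exists, and the limit along the upper quadrant $\{y\in T: y^k>x^k\ \forall k\}$ is $f(x)$ (conditions for empty quadrants being void). For a compact rectangle $B=\prod_k[p^k,q^k]$ with $p^k<q^k$, $\mathcal D_B$ carries the topology of the Skorohod distance $$d_B(f,g)=\inf_\lambda\Big\{\max_k\sup_{s\ne t}\Big|\log\tfrac{\lambda_k(t)-\lambda_k(s)}{t-s}\Big|+\sup_{x\in B}|f(x)-g(\lambda(x))|\Big\},$$ the infimum being over $\lambda=(\lambda_1,\dots,\lambda_d)$ with $\lambda_k$ an increasing bijection of $[p^k,q^k]$. A *jump sequence* is a sequence $\cdots<a_{-2}<a_{-1}<a_0=0<a_1<a_2<\cdots$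 without accumulation points in $\mathbb R$ (the values $a_k=\infty$, and $a_{-k}=-\infty$, are allowed from some $k$ on). $\mathcal S_{K_1}$ is the set of functions $\gamma:K_1\to\mathbb R$ of the form $\gamma(t)=\sum_{k\ge1}\mathbf 1\{a_k\le t\}+\sum_{k\ge 1}\mathbf 1\{a_{-k}>t\}$ for a jump sequence $(a_k)$, and $\mathcal D_K^0\subset\mathcal D_K$ is the set of functions of the form $$\psi(t,\xi)=V_0(\xi)\mathbf 1\{a_{-1}\le t<a_1\}+\sum_{k\ge1}V_k(\xi)\mathbf 1\{a_k\le t<a_{k+1}\}+\sum_{k\ge1}V_{-k}(\xi)\mathbf 1\{a_{-k-1}\le t<a_{-k}\}\qquad(*)$$ for a jump sequence $(a_k)$ and continuous functions $V_k:K_2\to\mathbb R$, $k\in\mathbb Z$. A point $x\in K$ is a *maximizer* of $f\in\mathcal D_K$ if $\sup_K f$ is finite and equals $f(x)$ or the limit of $f$ at $x$ along one of the nonempty quadrants. $\operatorname{sargmax}_K f$ and $\operatorname{largmax}_K f$ are the smallest and the largest maximizer of $f$ in the lexicographic order, when they exist. **Theorem.** Let $(\Psi_n,\Gamma_n)_{n\ge1}$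 and $(\Psi_0,\Gamma_0)$ be random elements of $\mathcal D_K^0\times\mathcal S_{K_1}$ on a probability space $(\Omega,\mathcal F,\mathbf P)$. Assume that: * for every $n\ge 0$, almost surely, $\Psi_n$ has a representation $(*)$ for the jump sequence $(a_k)$ of $\Gamma_n$; * almost surely, $\Psi_0$ has such a representation, for the jump sequence of $\Gamma_0$, in which each $V_j$ has a unique maximizer on $K_2$ and, for every nonempty finite $A\subset\mathbb Z$, there is exactly one $j\in A$ with $\sup_{K_2}V_j=\max_{i\in A}\sup_{K_2}V_i$; * $\Gamma_0$ has no fixed time of discontinuity: $\mathbf P(\Gamma_0\text{ is discontinuous at }t)=0$ for every $t\in K_1$; * for every $n\ge0$, $\operatorname{sargmax}_K\Psi_n$ and $\operatorname{largmax}_K\Psi_n$ exist almost surely. Suppose further that 1. for every compact rectangle $B=B_1\times B_2\subset K$ (a product of nondegenerate compact intervals, with $B_1\subset K_1$), the restrictions of $(\Psi_n,\Gamma_n)$ converge in distribution to that of $(\Psi_0,\Gamma_0)$ in $\mathcal D_B\times\mathcal D_{B_1}$ with the product topology; 2. $\big(\operatorname{sargmax}_K\Psi_n,\operatorname{largmax}_K\Psi_n\big)_{n\ge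 1}=O_{\mathbf P}(1)$. Then $$\big(\operatorname{sargmax}_K\Psi_n,\operatorname{largmax}_K\Psi_n\big)\rightsquigarrow\big(\operatorname{sargmax}_K\Psi_0,\operatorname{largmax}_K\Psi_0\big)\quad\text{in distribution, as } n\to\infty .$$ -/

import Mathlib

open Set Filter Topology MeasureTheory ProbabilityTheory
open scoped ENNReal

namespace Skorohod

section Spaces

variable {ι : Type*}

/-- The rectangle `∏ i, I i` in `ℝ^ι`. -/
abbrev rect (I : ι → Set ℝ) : Set (ι → ℝ) := Set.univ.pi I

/-- A nondegenerate, possibly unbounded, closed interval of the real line. -/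
structure IsClosedInterval (J : Set ℝ) : Prop where
  isClosed : IsClosed J
  ordConnected : J.OrdConnected
  nontrivial : J.Nontrivial

/-- The open quadrant `Q(ρ, x)` of `T` at `x`: the `k`-th coordinate is strictly above `x k` when
`ρ k = true`, and strictly below it when `ρ k = false`. -/
def quadrant {T : Set (ι → ℝ)} (ρ : ι → Bool) (x : T) : Set T :=
  {y | ∀ k, if ρ k = true then x.1 k < y.1 k else y.1 k < x.1 k}

/-- `l` is the `ρ`-limit of `f` at `x`. If the quadrant is empty the condition is void. -/
def IsQuadrantLimit {T : Set (ι → ℝ)} (f : T → ℝ) (ρ : ι → Bool) (x : T) (l : ℝ) : Prop :=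
  Tendsto f (𝓝[quadrant ρ x] x) (𝓝 l)

/-- The Skorohod space `D_T`, for a rectangle `T` (bounded or not): the functions `T → ℝ` that have
all quadrant limits and are continuous from above at every point. These conditions are local, so
for an unbounded rectangle they say that the restrictions to all compact subrectangles satisfy
them. -/
structure Space (T : Set (ι → ℝ)) where
  toFun : T → ℝ
  exists_limit : ∀ (x : T) (ρ : ι → Bool), ∃ l, IsQuadrantLimit toFun ρ x l
  continuous_from_above : ∀ x : T, IsQuadrantLimit toFun (fun _ => true) x (toFun x)

instance {T : Set (ι → ℝ)} : CoeFun (Space T) (fun _ => T → ℝ) := ⟨Space.toFun⟩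

theorem IsQuadrantLimit.restrict {T U : Set (ι → ℝ)} (h : U ⊆ T) {f : T → ℝ} {ρ : ι → Bool} {x : U}
    {l : ℝ} (hf : IsQuadrantLimit f ρ ⟨x.1, h x.2⟩ l) :
    IsQuadrantLimit (fun y : U => f ⟨y.1, h y.2⟩) ρ x l := by
  refine Tendsto.comp (f := fun y : U => (⟨y.1, h y.2⟩ : T)) hf ?_
  refine tendsto_nhdsWithin_of_tendsto_nhds_of_eventually_within _ ?_ ?_
  · exact ((continuous_inclusion h).tendsto x).mono_left nhdsWithin_le_nhds
  · filter_upwards [self_mem_nhdsWithin] with y hy using hy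

/-- Restriction of an element of `D_T` to `U ⊆ T`. -/
def Space.restrict {T U : Set (ι → ℝ)} (h : U ⊆ T) (f : Space T) : Space U where
  toFun y := f ⟨y.1, h y.2⟩
  exists_limit x ρ := by
    obtain ⟨l, hl⟩ := f.exists_limit ⟨x.1, h x.2⟩ ρ
    exact ⟨l, hl.restrict h⟩
  continuous_from_above x := (f.continuous_from_above ⟨x.1, h x.2⟩).restrict h

end Spaces

section Metric

variable {ι : Type*} {p q : ι → ℝ}

/-- The class `Λ_I` for `I = [a, b]`: increasing bijections of `[a, b]` onto itself. -/
abbrev TimeChange (a b : ℝ) : Type := Icc a b ≃o Icc a b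

/-- The functional `|||λ||| = sup_{s ≠ t} |log ((λ t - λ s) / (t - s))|`, with values in
`[0, ∞]`. -/
noncomputable def distortion {a b : ℝ} (l : TimeChange a b) : ℝ≥0∞ :=
  ⨆ (s : Icc a b) (t : Icc a b) (_ : s ≠ t),
    ENNReal.ofReal |Real.log (((l t : ℝ) - (l s : ℝ)) / ((t : ℝ) - (s : ℝ)))|

/-- The action of a coordinatewise time change on the rectangle `[p, q]`. -/
def applyChange (l : ∀ k, TimeChange (p k) (q k)) (x : Icc p q) : Icc p q :=
  ⟨fun k => l k ⟨x.1 k, x.2.1 k, x.2.2 k⟩, fun k => (l k _).2.1, fun k => (l k _).2.2⟩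

/-- The Skorohod distance
`d_B(f, g) = inf_λ { max_k |||λ_k||| + sup_x |f x - g (λ x)| }` on `D_B`, `B = [p, q]`. -/
noncomputable def skorohodDist (f g : Space (Icc p q)) : ℝ≥0∞ :=
  ⨅ l : ∀ k, TimeChange (p k) (q k),
    (⨆ k, distortion (l k)) + ⨆ x, edist (f x) (g (applyChange l x))

theorem distortion_refl (a b : ℝ) : distortion (OrderIso.refl (Icc a b)) = 0 := by
  simp only [distortion, ENNReal.iSup_eq_zero]
  intro s t hst
  have : (t : ℝ) - s ≠ 0 := sub_ne_zero.2 (fun h => hst (Subtype.ext h.symm))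
  simp [div_self this]

theorem distortion_symm_le {a b : ℝ} (l : TimeChange a b) : distortion l.symm ≤ distortion l := by
  refine iSup_le fun s => iSup_le fun t => iSup_le fun hst => ?_
  refine le_trans (le_of_eq ?_) (le_iSup_of_le (l.symm s) (le_iSup_of_le (l.symm t)
    (le_iSup_of_le (fun h => hst (l.symm.injective h)) le_rfl)))
  rw [OrderIso.apply_symm_apply, OrderIso.apply_symm_apply, ← inv_div, Real.log_inv, abs_neg]

theorem distortion_trans_le {a b : ℝ} (l m : TimeChange a b) :
    distortion (l.trans m) ≤ distortion l + distortion m := by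
  refine iSup_le fun s => iSup_le fun t => iSup_le fun hst => ?_
  have h1 : ENNReal.ofReal |Real.log (((l t : ℝ) - l s) / ((t : ℝ) - s))| ≤ distortion l :=
    le_iSup_of_le s (le_iSup_of_le t (le_iSup_of_le hst le_rfl))
  have h2 : ENNReal.ofReal |Real.log (((m (l t) : ℝ) - m (l s)) / ((l t : ℝ) - l s))|
      ≤ distortion m :=
    le_iSup_of_le (l s) (le_iSup_of_le (l t)
      (le_iSup_of_le (fun h => hst (l.injective h)) le_rfl))
  refine le_trans ?_ (add_le_add h1 h2)
  rw [← ENNReal.ofReal_add (abs_nonneg _) (abs_nonneg _)]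
  refine ENNReal.ofReal_le_ofReal (le_trans (le_of_eq ?_) (abs_add_le _ _))
  have n1 : (t : ℝ) - s ≠ 0 := sub_ne_zero.2 fun h => hst (Subtype.ext h.symm)
  have n2 : (l t : ℝ) - l s ≠ 0 :=
    sub_ne_zero.2 fun h => hst (l.injective (Subtype.ext h.symm))
  have n3 : (m (l t) : ℝ) - m (l s) ≠ 0 :=
    sub_ne_zero.2 fun h => hst (l.injective (m.injective (Subtype.ext h.symm)))
  rw [← Real.log_mul (div_ne_zero n2 n1) (div_ne_zero n3 n2)]
  congr 2
  simp only [OrderIso.trans_apply]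
  field_simp

theorem skorohodDist_self (f : Space (Icc p q)) : skorohodDist f f = 0 := by
  refine le_antisymm (iInf_le_of_le (fun k => OrderIso.refl _) ?_) bot_le
  have h : ∀ x : Icc p q, applyChange (fun k => OrderIso.refl (Icc (p k) (q k))) x = x :=
    fun x => rfl
  simp [distortion_refl, h]

theorem skorohodDist_comm_le (f g : Space (Icc p q)) : skorohodDist f g ≤ skorohodDist g f := by
  refine le_iInf fun l => iInf_le_of_le (fun k => (l k).symm) ?_
  refine add_le_add (iSup_mono fun k => distortion_symm_le _) (iSup_le fun x => ?_)
  have h : applyChange l (applyChange (fun k => (l k).symm) x) = x := by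
    apply Subtype.ext
    funext k
    simp [applyChange]
  refine le_iSup_of_le (applyChange (fun k => (l k).symm) x) ?_
  rw [h, edist_comm]

theorem skorohodDist_triangle (f g h : Space (Icc p q)) :
    skorohodDist f h ≤ skorohodDist f g + skorohodDist g h := by
  unfold skorohodDist
  rw [ENNReal.iInf_add]
  refine le_iInf fun l => ?_
  rw [ENNReal.add_iInf]
  refine le_iInf fun m => iInf_le_of_le (fun k => (l k).trans (m k)) ?_
  rw [add_add_add_comm]
  refine add_le_add (iSup_le fun k => (distortion_trans_le _ _).trans
    (add_le_add (le_iSup (fun k => distortion (l k)) k) (le_iSup (fun k => distortion (m k)) k)))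
    (iSup_le fun x => ?_)
  refine (edist_triangle _ (g (applyChange l x)) _).trans (add_le_add
    (le_iSup (fun x => edist (f x) (g (applyChange l x))) x) ?_)
  exact le_iSup (fun x => edist (g x) (h (applyChange m x))) (applyChange l x)

/-- `D_B`, for a compact rectangle `B = [p, q]`, carries the topology of the Skorohod distance. -/
noncomputable instance : PseudoEMetricSpace (Space (Icc p q)) where
  edist := skorohodDist
  edist_self := skorohodDist_self
  edist_comm f g := le_antisymm (skorohodDist_comm_le f g) (skorohodDist_comm_le g f)
  edist_triangle := skorohodDist_triangle

end Metric

section JumpFunctions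

variable {m : ℕ}

/-- A jump sequence `… < a (-2) < a (-1) < a 0 = 0 < a 1 < a 2 < …` without accumulation points in
`ℝ`. The values `⊤` and `⊥` are allowed, so there may be finitely many jumps on a side of `0`. -/
structure IsJumpSequence (a : ℤ → EReal) : Prop where
  zero : a 0 = 0
  monotone : Monotone a
  strict : ∀ k : ℤ, a k < a (k + 1) ∨ a k = ⊤ ∨ a (k + 1) = ⊥
  unbounded_above : ∀ t : ℝ, ∃ k : ℤ, (t : EReal) < a k
  unbounded_below : ∀ t : ℝ, ∃ k : ℤ, a k < (t : EReal)

/-- The pure jump function with jumps `a`: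
`t ↦ ∑_{k ≥ 1} 1{a k ≤ t} + ∑_{k ≥ 1} 1{t < a (-k)}`. -/
noncomputable def pureJump (a : ℤ → EReal) (t : ℝ) : ℝ :=
  ({k : ℤ | 1 ≤ k ∧ a k ≤ (t : EReal)}.ncard : ℝ) +
    ({k : ℤ | 1 ≤ k ∧ (t : EReal) < a (-k)}.ncard : ℝ)

/-- The interval `J ⊆ ℝ` as a one-dimensional rectangle. -/
abbrev line (J : Set ℝ) : Set (Fin 1 → ℝ) := rect fun _ => J

/-- The jumps of `γ : J → ℝ` are the points of `a` in `J`. -/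
def HasJumps {J : Set ℝ} (γ : line J → ℝ) (a : ℤ → EReal) : Prop :=
  IsJumpSequence a ∧ ∀ x : line J, γ x = pureJump a (x.1 0)

/-- The space `S_J` of restrictions to `J` of pure jump functions. -/
def PureJumpSpace (J : Set ℝ) : Set (Space (line J)) := {γ | ∃ a, HasJumps γ a}

/-- The factor `K₂` of `K = K₁ × K₂`, when `K = rect I` and `K₁ = I 0`. -/
abbrev tailRect (I : Fin (m + 1) → Set ℝ) : Set (Fin m → ℝ) := rect fun k => I k.succ

/-- The projection `K₁ × K₂ → K₂`, `(t, ξ) ↦ ξ`. -/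
def tailPoint {I : Fin (m + 1) → Set ℝ} (x : rect I) : tailRect I :=
  ⟨fun k => x.1 k.succ, fun k _ => x.2 k.succ (mem_univ _)⟩

/-- `ψ(t, ξ) = V 0 ξ 1{a (-1) ≤ t < a 1} + ∑_{k ≥ 1} V k ξ 1{a k ≤ t < a (k+1)}
  + ∑_{k ≥ 1} V (-k) ξ 1{a (-k-1) ≤ t < a (-k)}` on `K₁ × K₂`, with `a` a jump sequence and
continuous functions `V k : K₂ → ℝ`. Exactly one of the indicators is nonzero at each `t`. -/
structure HasRepresentation {I : Fin (m + 1) → Set ℝ} (ψ : rect I → ℝ) (a : ℤ → EReal)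
    (V : ℤ → tailRect I → ℝ) : Prop where
  isJumpSequence : IsJumpSequence a
  continuous : ∀ k, Continuous (V k)
  eq_zero : ∀ x : rect I, a (-1) ≤ (x.1 0 : EReal) → (x.1 0 : EReal) < a 1 →
    ψ x = V 0 (tailPoint x)
  eq_pos : ∀ (x : rect I) (k : ℤ), 1 ≤ k → a k ≤ (x.1 0 : EReal) → (x.1 0 : EReal) < a (k + 1) →
    ψ x = V k (tailPoint x)
  eq_neg : ∀ (x : rect I) (k : ℤ), 1 ≤ k → a (-k - 1) ≤ (x.1 0 : EReal) →
    (x.1 0 : EReal) < a (-k) → ψ x = V (-k) (tailPoint x)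

/-- The space `D_K^0`, `K = rect I`. -/
def JumpSpace (I : Fin (m + 1) → Set ℝ) : Set (Space (rect I)) :=
  {ψ | ∃ a V, HasRepresentation ψ a V}

/-- Every `V j` has a unique maximizer on `K₂`, and among any finite number of the functions `V j`
there is only one whose maximum over `K₂` is the largest. -/
def UniqueMaxima {X : Type*} (V : ℤ → X → ℝ) : Prop :=
  (∀ j, ∃! ξ, ∀ η, V j η ≤ V j ξ) ∧
    ∀ (A : Finset ℤ) (hA : A.Nonempty),
      ∃! j, j ∈ A ∧ (A.sup' hA fun i => ⨆ ξ, V i ξ) = ⨆ ξ, V j ξ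

end JumpFunctions

section Argmax

variable {d : ℕ} {T : Set (Fin d → ℝ)}

/-- `x` is a maximizer of `f` over `T`: one of the quadrant limits of `f` at `x` equals
`sup_T f`. The value `f x` counts as one of them: it is the limit from above, except where the
upper quadrant is empty. -/
def IsMaximizer (f : Space T) (x : T) : Prop :=
  ∃ M : ℝ, IsLUB (range f) M ∧
    (f x = M ∨ ∃ ρ : Fin d → Bool, (𝓝[quadrant ρ x] x).NeBot ∧ IsQuadrantLimit f ρ x M)

/-- `x` is the smallest maximizer of `f` in the lexicographic order. -/
def IsSargmax (f : Space T) (x : T) : Prop :=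
  IsMaximizer f x ∧
    ∀ y, IsMaximizer f y → ∀ k, (∀ j, j < k → x.1 j = y.1 j) → x.1 k ≤ y.1 k

/-- `x` is the largest maximizer of `f` in the lexicographic order. -/
def IsLargmax (f : Space T) (x : T) : Prop :=
  IsMaximizer f x ∧
    ∀ y, IsMaximizer f y → ∀ k, (∀ j, j < k → x.1 j = y.1 j) → y.1 k ≤ x.1 k

/-- The functionals sargmax and largmax over `T` are well defined (finite) at `f`. -/
def ArgmaxDefined (f : Space T) : Prop := (∃ x, IsSargmax f x) ∧ ∃ x, IsLargmax f x

theorem IsSargmax.unique {f : Space T} {x y : T} (hx : IsSargmax f x) (hy : IsSargmax f y) :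
    x = y := by
  apply Subtype.ext
  funext k
  induction k using WellFoundedLT.induction with
  | ind k ih =>
    exact le_antisymm (hx.2 y hy.1 k ih) (hy.2 x hx.1 k fun j hj => (ih j hj).symm)

theorem IsLargmax.unique {f : Space T} {x y : T} (hx : IsLargmax f x) (hy : IsLargmax f y) :
    x = y := by
  apply Subtype.ext
  funext k
  induction k using WellFoundedLT.induction with
  | ind k ih =>
    exact le_antisymm (hy.2 x hx.1 k fun j hj => (ih j hj).symm) (hx.2 y hy.1 k ih)

open Classical in
/-- The smallest maximizer of `f` over `T` (`0` if it does not exist). -/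
noncomputable def sargmax (f : Space T) : Fin d → ℝ :=
  if h : ∃ x, IsSargmax f x then (h.choose : Fin d → ℝ) else 0

open Classical in
/-- The largest maximizer of `f` over `T` (`0` if it does not exist). -/
noncomputable def largmax (f : Space T) : Fin d → ℝ :=
  if h : ∃ x, IsLargmax f x then (h.choose : Fin d → ℝ) else 0

end Argmax

section Convergence

variable {m : ℕ}

/-- The space `D_B × D_{B₁}`, where `B = [p, q]` and `B₁ = [p 0, q 0]`. -/
def JointSpace (p q : Fin (m + 1) → ℝ) : Type :=
  Space (Icc p q) × Space (Icc (fun _ : Fin 1 => p 0) (fun _ : Fin 1 => q 0))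

/-- The product topology on `D_B × D_{B₁}`. -/
noncomputable instance (p q : Fin (m + 1) → ℝ) : TopologicalSpace (JointSpace p q) :=
  inferInstanceAs (TopologicalSpace
    (Space (Icc p q) × Space (Icc (fun _ : Fin 1 => p 0) (fun _ : Fin 1 => q 0))))

/-- The Borel sigma-algebra of `D_B × D_{B₁}`. -/
noncomputable instance (p q : Fin (m + 1) → ℝ) : MeasurableSpace (JointSpace p q) := borel _

instance (p q : Fin (m + 1) → ℝ) : BorelSpace (JointSpace p q) := ⟨rfl⟩

theorem Icc_subset_line {p q : Fin (m + 1) → ℝ} (hpq : p ≤ q) {I : Fin (m + 1) → Set ℝ}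
    (h : Icc p q ⊆ rect I) :
    Icc (fun _ : Fin 1 => p 0) (fun _ : Fin 1 => q 0) ⊆ line (I 0) := by
  intro x hx k _
  have hk : k = 0 := Subsingleton.elim _ _
  subst hk
  have hy : Function.update p 0 (x 0) ∈ Icc p q := by
    refine ⟨fun j => ?_, fun j => ?_⟩ <;> by_cases hj : j = 0
    · subst hj; simpa using hx.1 0
    · simp [hj]
    · subst hj; simpa using hx.2 0
    · simpa [hj] using hpq j
  simpa using h hy 0 (mem_univ _)

/-- The restriction of `(ψ, γ)` to the pair of compact rectangles `B = [p, q]`,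
`B₁ = [p 0, q 0]`. -/
def restrictPair {p q : Fin (m + 1) → ℝ} (hpq : p ≤ q) {I : Fin (m + 1) → Set ℝ}
    (h : Icc p q ⊆ rect I) (ψ : Space (rect I)) (γ : Space (line (I 0))) : JointSpace p q :=
  (ψ.restrict h, γ.restrict (Icc_subset_line hpq h))

/-- `X n = O_P(1)`. -/
def BoundedInProbability {Ω E : Type*} [MeasurableSpace Ω] [Norm E] (P : Measure Ω)
    (X : ℕ → Ω → E) : Prop :=
  ∀ ε : ℝ≥0∞, 0 < ε → ∃ M : ℝ, ∀ n, P {ω | M < ‖X n ω‖} ≤ ε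

end Convergence

end Skorohod

/-!
The pair `S ψ = (sargmax ψ, largmax ψ)` is treated as a functional of `(ψ, γ)` which is continuous
at almost every value of the limit, once the parameter set is cut down to a compact rectangle
`B = K ∩ [-M, M]^d` whose interior contains the extreme maximizers with high probability.

A jump sequence enters only through the monotone integer-valued function `κ` that counts the jumps
with a sign (`StepData`): `γ t = |κ t|` and `ψ(t, ξ) = V (κ t) ξ`, and `κ` can be recovered on an
interval from `γ`.

*Continuity.* The unique-maximum condition makes the maximum of the limit a strict peak:
it is attained over a single interval `[a, b)` of constancy of `κ₀` and at a single `ξ`, so that the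
extreme maximizers are `(a, ξ)` and `(b, ξ)` (`StepData.exists_isPeak`), and on `B` the values away
from the peak stay below the maximum by a gap (`IsPeak.exists_gap`). If `(ψ, γ)` is close to the
limit in the product of the Skorohod topologies, then `γ = γ₀ ∘ l` for a time change `l` close to
the identity, because both functions take integer values; as `ψ` depends on the time only through
the pieces between the jumps of `γ`, the same `l` makes `ψ` uniformly close to `ψ₀ ∘ (l × id)`
(`StepData.exists_timeChange`). Hence the maximizers of `ψ` lie over `[l⁻¹ a, l⁻¹ b]` and near `ξ`,
and each of them can be moved in time along this interval: the extreme ones have first coordinates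
`l⁻¹ a` and `l⁻¹ b` (`StepData.dist_argmax_lt`).

*Measurability.* In a Skorohod space the functions exceeding a level somewhere in an open set form
an open set, whence the random set of maximizers hits each compact set on a measurable event
(`nearMaxSet_inter_nonempty_iff`). The lexicographically smallest point of such a random closed set
is measurable, one coordinate at a time (`aemeasurable_of_lexicographic_least`).

*Conclusion.* For closed `F`, let `G` be the set of the restrictions to `B` of pairs `(ψ, γ)` with
`S ψ ∈ F` inside `B`. The portmanteau theorem on the Skorohod space is applied to the closure of
`G`: by continuity, a limit in this closure with its maximizers inside `B` has them in `F`
(`StepData.mem_of_mem_closure`). This avoids both a representation with almost sure convergence and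
the measurability of `S` as a functional on the Skorohod space.
-/

namespace Skorohod

/-! ### Time changes of small distortion -/

theorem exists_abs_timeChange_sub_lt (a b : ℝ) {r : ℝ} (hr : 0 < r) :
    ∃ δ : ℝ≥0∞, 0 < δ ∧ ∀ l : TimeChange a b, distortion l < δ →
      ∀ t : Icc a b, |(l t : ℝ) - t| < r := by
  rcases lt_or_ge b a with hab | hab
  · exact ⟨1, one_pos, fun l _ t => absurd (t.2.1.trans t.2.2) (not_le.2 hab)⟩
  have hcont : Tendsto (fun e : ℝ => (b - a) * (Real.exp e - 1)) (𝓝 0) (𝓝 0) := by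
    have : Continuous fun e : ℝ => (b - a) * (Real.exp e - 1) := by fun_prop
    simpa using this.tendsto 0
  have hcont' : Tendsto (fun e : ℝ => (b - a) * (1 - Real.exp (-e))) (𝓝 0) (𝓝 0) := by
    have : Continuous fun e : ℝ => (b - a) * (1 - Real.exp (-e)) := by fun_prop
    simpa using this.tendsto 0
  obtain ⟨e, ⟨he1, he2⟩, he0 : 0 < e⟩ := ((((hcont.eventually (gt_mem_nhds hr)).and
    (hcont'.eventually (gt_mem_nhds hr))).filter_mono
    (nhdsWithin_le_nhds (s := Ioi 0))).and self_mem_nhdsWithin).exists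
  refine ⟨ENNReal.ofReal e, ENNReal.ofReal_pos.2 he0, fun l hl t => ?_⟩
  let z : Icc a b := ⟨a, le_rfl, hab⟩
  -- A time change fixes the left endpoint, so the distortion bounds the slopes of its chords there.
  have hz : l z = z := by
    have hbot : ∀ x, z ≤ x := fun x => x.2.1
    refine le_antisymm ?_ (hbot _)
    have := hbot (l.symm z)
    simpa using l.monotone this
  rcases eq_or_ne z t with h | h
  · rw [← h, hz]; simpa using hr
  have hta : (0 : ℝ) < t - a := by
    refine lt_of_le_of_ne (sub_nonneg.2 t.2.1) fun h' => h (Subtype.ext ?_)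
    change a = t
    linarith
  have hzt : z < t := by
    change a < (t : ℝ)
    linarith
  have hlt : (0 : ℝ) < l t - a := by
    have h1 : (l z : ℝ) < l t := l.strictMono hzt
    rw [hz] at h1
    exact sub_pos.2 h1
  have h1 : ENNReal.ofReal |Real.log (((l t : ℝ) - a) / ((t : ℝ) - a))| < ENNReal.ofReal e := by
    refine lt_of_le_of_lt ?_ hl
    have h2 := le_iSup_of_le z (le_iSup_of_le t (le_iSup_of_le h le_rfl)) (f := fun s : Icc a b =>
      ⨆ (t : Icc a b) (_ : s ≠ t),
        ENNReal.ofReal |Real.log (((l t : ℝ) - (l s : ℝ)) / ((t : ℝ) - (s : ℝ)))|)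
    rwa [hz] at h2
  have h3 := (ENNReal.ofReal_lt_ofReal_iff he0).1 h1
  rw [abs_lt] at h3
  have hq : 0 < ((l t : ℝ) - a) / ((t : ℝ) - a) := div_pos hlt hta
  have h4 := (Real.log_lt_iff_lt_exp hq).1 h3.2
  have h5 := (Real.lt_log_iff_exp_lt hq).1 h3.1
  rw [div_lt_iff₀ hta] at h4
  rw [lt_div_iff₀ hta] at h5
  have htb : (t : ℝ) - a ≤ b - a := sub_le_sub_right t.2.2 _
  have e1 : 0 ≤ Real.exp e - 1 := by have := Real.add_one_le_exp e; linarith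
  have e2 : 0 ≤ 1 - Real.exp (-e) := by
    have := Real.exp_le_one_iff.2 (neg_nonpos.2 he0.le); linarith
  rw [abs_lt]
  constructor
  · nlinarith [mul_le_mul_of_nonneg_right htb e2]
  · nlinarith [mul_le_mul_of_nonneg_right htb e1]

theorem exists_timeChange_of_edist_lt {ι : Type*} {p q : ι → ℝ} {f g : Space (Icc p q)}
    {δ : ℝ≥0∞} (h : edist f g < δ) :
    ∃ l : ∀ k, TimeChange (p k) (q k), (∀ k, distortion (l k) < δ) ∧
      ∀ x, edist (f x) (g (applyChange l x)) < δ := by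
  obtain ⟨l, hl⟩ := iInf_lt_iff.1 (show skorohodDist f g < δ from h)
  refine ⟨l, fun k => ?_, fun x => ?_⟩
  · exact (le_iSup (fun k => distortion (l k)) k).trans_lt (lt_of_le_of_lt le_self_add hl)
  · exact (le_iSup (fun x => edist (f x) (g (applyChange l x))) x).trans_lt
      (lt_of_le_of_lt le_add_self hl)

/-- Two functions at small Skorohod distance are uniformly close up to time changes uniformly close
to the identity. -/
theorem exists_timeChange_close {ι : Type*} [Finite ι] (p q : ι → ℝ) {r : ℝ} (hr : 0 < r) :
    ∃ δ : ℝ≥0∞, 0 < δ ∧ ∀ f g : Space (Icc p q), edist f g < δ →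
      ∃ l : ∀ k, TimeChange (p k) (q k), (∀ k t, |(l k t : ℝ) - t| < r) ∧
        ∀ x, |f x - g (applyChange l x)| < r := by
  cases nonempty_fintype ι
  choose δ hδ0 hδ using fun k => exists_abs_timeChange_sub_lt (p k) (q k) hr
  refine ⟨min (ENNReal.ofReal r) (Finset.univ.inf δ), lt_min (ENNReal.ofReal_pos.2 hr) ?_,
    fun f g hfg => ?_⟩
  · rw [Finset.lt_inf_iff ENNReal.zero_lt_top]
    exact fun k _ => hδ0 k
  · obtain ⟨l, hl, hx⟩ := exists_timeChange_of_edist_lt hfg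
    refine ⟨l, fun k => hδ k (l k) ?_, fun x => ?_⟩
    · exact (hl k).trans_le ((min_le_right _ _).trans (Finset.inf_le (Finset.mem_univ k)))
    · have := (hx x).trans_le (min_le_left _ _)
      rwa [edist_dist, ENNReal.ofReal_lt_ofReal_iff hr, Real.dist_eq] at this

/-- Time changes of small distortion do not move a given point of `U` out of `U`. -/
theorem isOpen_setOf_exists_lt {ι : Type*} [Finite ι] {p q : ι → ℝ} {U : Set (ι → ℝ)}
    (hU : IsOpen U) (c : ℝ) :
    IsOpen {f : Space (Icc p q) | ∃ x : Icc p q, x.1 ∈ U ∧ c < f x} := by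
  cases nonempty_fintype ι
  rw [EMetric.isOpen_iff]
  rintro f ⟨x, hxU, hx⟩
  obtain ⟨e, he, hball⟩ := Metric.isOpen_iff.1 hU x.1 hxU
  obtain ⟨δ, hδ, h⟩ := exists_timeChange_close p q (lt_min he (sub_pos.2 hx))
  refine ⟨δ, hδ, fun g hg => ?_⟩
  rw [Metric.mem_eball, edist_comm] at hg
  obtain ⟨l, hl, hfg⟩ := h f g hg
  refine ⟨applyChange l x, hball ?_, ?_⟩
  · rw [Metric.mem_ball, dist_pi_lt_iff he]
    exact fun k => (hl k _).trans_le (min_le_left _ _)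
  · have := (abs_lt.1 ((hfg x).trans_le (min_le_right _ _))).2
    linarith

/-! ### Step functions with values in the integers -/

section StepFunctions

variable {m : ℕ}

/-- A function `ψ` on `K₁ × K₂` and a function `γ` on `K₁` that are driven by the same step
function `κ`: `ψ(t, ξ) = V (κ t) ξ` and `γ t = |κ t|`. At the point `t`, the integer `κ t` is the
index of the function `V k` which is active there, negative to the left of the origin. The jumps of
`κ` are not required to have size one. -/
structure StepData {I : Fin (m + 1) → Set ℝ} (ψ : rect I → ℝ) (γ : line (I 0) → ℝ)
    (κ : ℝ → ℤ) (V : ℤ → tailRect I → ℝ) : Prop where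
  monotone : Monotone κ
  zero : κ 0 = 0
  right : ∀ t, ∀ᶠ s in 𝓝[≥] t, κ s = κ t
  continuous : ∀ k, Continuous (V k)
  apply_eq : ∀ x, ψ x = V (κ (x.1 0)) (tailPoint x)
  jumps_eq : ∀ x, γ x = |(κ (x.1 0) : ℝ)|

theorem IsJumpSequence.exists_mem_Ico {a : ℤ → EReal} (ha : IsJumpSequence a) (t : ℝ) :
    ∃ k, a k ≤ t ∧ (t : EReal) < a (k + 1) := by
  obtain ⟨u, hu⟩ := ha.unbounded_above t
  obtain ⟨l, hl⟩ := ha.unbounded_below t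
  obtain ⟨k, hk, hmax⟩ := Int.exists_greatest_of_bdd (P := fun k => a k ≤ t)
    ⟨u, fun z hz => by
      by_contra h
      exact absurd (hu.trans_le (ha.monotone (not_le.1 h).le)) (not_lt.2 hz)⟩ ⟨l, hl.le⟩
  refine ⟨k, hk, ?_⟩
  by_contra h
  have := hmax _ (not_lt.1 h)
  omega

theorem IsJumpSequence.zero_lt_one {a : ℤ → EReal} (ha : IsJumpSequence a) : 0 < a 1 := by
  have h01 : a 0 ≤ a 1 := ha.monotone (by norm_num)
  rcases ha.strict 0 with h | h | h
  · simpa [ha.zero] using h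
  · simp [ha.zero] at h
  · rw [ha.zero] at h01
    rw [zero_add] at h
    simp [h] at h01

theorem IsJumpSequence.pureJump_eq {a : ℤ → EReal} (ha : IsJumpSequence a) {t : ℝ} {k : ℤ}
    (h1 : a k ≤ t) (h2 : (t : EReal) < a (k + 1)) :
    pureJump a t = |((if 0 ≤ k then k else k + 1 : ℤ) : ℝ)| := by
  have hle : ∀ i, a i ≤ t → i ≤ k := fun i hi => by
    by_contra h
    exact absurd (h2.trans_le (ha.monotone (by omega))) (not_lt.2 hi)
  have hlt : ∀ i, (t : EReal) < a i → k < i := fun i hi => by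
    by_contra h
    exact absurd (hi.trans_le (ha.monotone (not_lt.1 h))) (not_lt.2 h1)
  have e1 : {i : ℤ | 1 ≤ i ∧ a i ≤ (t : EReal)} = (Finset.Icc 1 k : Finset ℤ) := by
    ext i
    simp only [mem_ofPred_eq, Finset.coe_Icc, mem_Icc]
    exact ⟨fun h => ⟨h.1, hle i h.2⟩, fun h => ⟨h.1, (ha.monotone h.2).trans h1⟩⟩
  have e2 : {i : ℤ | 1 ≤ i ∧ (t : EReal) < a (-i)} = (Finset.Icc 1 (-k - 1) : Finset ℤ) := by
    ext i
    simp only [mem_ofPred_eq, Finset.coe_Icc, mem_Icc]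
    refine ⟨fun h => ⟨h.1, ?_⟩, fun h => ⟨h.1, h2.trans_le (ha.monotone (by omega))⟩⟩
    have := hlt _ h.2
    omega
  rw [pureJump, e1, e2, ncard_coe_finset, ncard_coe_finset, Int.card_Icc, Int.card_Icc]
  split_ifs with hk
  · have e : (-k - 1 + 1 - 1).toNat = 0 := by omega
    rw [e, abs_of_nonneg (by exact_mod_cast hk)]
    have : ((k + 1 - 1).toNat : ℤ) = k := by omega
    have h' : (((k + 1 - 1).toNat : ℤ) : ℝ) = k := by rw [this]
    push_cast at h' ⊢
    simpa using h'
  · have e : (k + 1 - 1).toNat = 0 := by omega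
    have hk' : k + 1 ≤ 0 := by omega
    rw [e, abs_of_nonpos (by exact_mod_cast hk')]
    have : ((-k - 1 + 1 - 1).toNat : ℤ) = -(k + 1) := by omega
    have h' : (((-k - 1 + 1 - 1).toNat : ℤ) : ℝ) = ((-(k + 1) : ℤ) : ℝ) := by rw [this]
    push_cast at h' ⊢
    simpa using h'

theorem HasRepresentation.apply_eq {I : Fin (m + 1) → Set ℝ} {ψ : rect I → ℝ} {a : ℤ → EReal}
    {V : ℤ → tailRect I → ℝ} (h : HasRepresentation ψ a V) (x : rect I) {k : ℤ}
    (h1 : a k ≤ (x.1 0 : EReal)) (h2 : (x.1 0 : EReal) < a (k + 1)) :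
    ψ x = V (if 0 ≤ k then k else k + 1) (tailPoint x) := by
  have hm := h.isJumpSequence.monotone
  rcases lt_trichotomy k 0 with hk | hk | hk
  · rw [if_neg (by omega)]
    rcases (show k + 1 ≤ 0 by omega).lt_or_eq with hk' | hk'
    · have := h.eq_neg x (-(k + 1)) (by omega) (by simpa using h1) (by simpa using h2)
      simpa using this
    · rw [hk']
      have e : k = -1 := by omega
      subst e
      exact h.eq_zero x h1 (h2.trans_le (hm (by norm_num)))
  · subst hk
    simpa using h.eq_zero x ((hm (by norm_num)).trans h1) (by simpa using h2)
  · rw [if_pos hk.le]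
    exact h.eq_pos x k (by omega) h1 h2

/-- Both the jump functions and the functions represented by a jump sequence are driven by the step
function counting the jumps with a sign. The intervals `[a (-1), 0)` and `[0, a 1)` share the index
`0`, which is why the index of `[a k, a (k + 1))` is `k + 1` for negative `k`. -/
theorem HasRepresentation.exists_stepData {I : Fin (m + 1) → Set ℝ} {ψ : rect I → ℝ}
    {γ : line (I 0) → ℝ} {a : ℤ → EReal} {V : ℤ → tailRect I → ℝ}
    (hψ : HasRepresentation ψ a V) (hγ : HasJumps γ a) : ∃ κ, StepData ψ γ κ V := by
  have ha := hγ.1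
  choose k hk1 hk2 using ha.exists_mem_Ico
  have huniq : ∀ s t : ℝ, (s : EReal) < a (k t + 1) → k s ≤ k t := fun s t h => by
    by_contra hc
    exact absurd (h.trans_le (ha.monotone (by omega : k t + 1 ≤ k s))) (not_lt.2 (hk1 s))
  have hmono : Monotone k := fun s t hst =>
    huniq s t ((EReal.coe_le_coe_iff.2 hst).trans_lt (hk2 t))
  refine ⟨fun t => if 0 ≤ k t then k t else k t + 1, ?_, ?_, ?_, hψ.continuous, ?_, ?_⟩
  · intro s t hst
    have := hmono hst
    change (if 0 ≤ k s then k s else k s + 1) ≤ (if 0 ≤ k t then k t else k t + 1)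
    split_ifs <;> omega
  · have h0 : k 0 = 0 := by
      apply le_antisymm
      · by_contra h
        have := (ha.monotone (by omega : 1 ≤ k 0)).trans (hk1 0)
        exact absurd ha.zero_lt_one (not_lt.2 this)
      · by_contra h
        have := (hk2 0).trans_le (ha.monotone (by omega : k 0 + 1 ≤ 0))
        rw [ha.zero] at this
        simp at this
    simp [h0]
  · intro t
    have : ∀ᶠ s : ℝ in 𝓝 t, (s : EReal) < a (k t + 1) :=
      continuous_coe_real_ereal.continuousAt.eventually (gt_mem_nhds (hk2 t))
    filter_upwards [nhdsWithin_le_nhds this, self_mem_nhdsWithin] with s hs hts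
    rw [le_antisymm (huniq s t hs) (hmono hts)]
  · exact fun x => hψ.apply_eq x (hk1 _) (hk2 _)
  · exact fun x => (hγ.2 x).trans (ha.pureJump_eq (hk1 _) (hk2 _))

/-- An integer-valued monotone function is constant on a left neighbourhood of every point. -/
theorem exists_eventually_eq_nhdsLT {κ : ℝ → ℤ} (hκ : Monotone κ) (t : ℝ) :
    ∃ j, ∀ᶠ s in 𝓝[<] t, κ s = j := by
  obtain ⟨j, ⟨s, hs, rfl⟩, hmax⟩ := Int.exists_greatest_of_bdd (P := fun k => ∃ s < t, κ s = k)
    ⟨κ t, fun z ⟨s, hs, hz⟩ => hz ▸ hκ hs.le⟩ ⟨_, t - 1, by simp, rfl⟩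
  refine ⟨κ s, ?_⟩
  filter_upwards [Ioo_mem_nhdsLT hs] with r hr
  exact le_antisymm (hmax _ ⟨r, hr.2, rfl⟩) (hκ hr.1.le)

/-- The step function `κ` can be recovered from `|κ|`: it does not jump while `|κ|` is constant. -/
theorem eq_of_forall_abs_eq {κ : ℝ → ℤ} (hκ : Monotone κ) (h0 : κ 0 = 0) {s t : ℝ}
    (h : ∀ r ∈ uIcc s t, |(κ r : ℝ)| = |(κ s : ℝ)|) : κ s = κ t := by
  have h' : ∀ r ∈ uIcc s t, |κ r| = |κ s| := fun r hr => by exact_mod_cast h r hr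
  have ht := h' t right_mem_uIcc
  by_cases hz : (0 : ℝ) ∈ uIcc s t
  · have := h' 0 hz
    rw [h0, abs_zero, eq_comm, abs_eq_zero] at this
    rw [this, abs_zero, abs_eq_zero] at ht
    rw [this, ht]
  · rcases le_or_gt 0 s with hs | hs <;> rcases le_or_gt 0 t with ht0 | ht0
    · have h1 := hκ hs
      have h2 := hκ ht0
      rw [h0] at h1 h2
      rw [abs_of_nonneg h1, abs_of_nonneg h2] at ht
      exact ht.symm
    · exact absurd (mem_uIcc.2 (Or.inr ⟨ht0.le, hs⟩)) hz
    · exact absurd (mem_uIcc.2 (Or.inl ⟨hs.le, ht0⟩)) hz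
    · have h1 := hκ hs.le
      have h2 := hκ ht0.le
      rw [h0] at h1 h2
      rw [abs_of_nonpos h1, abs_of_nonpos h2] at ht
      omega

theorem continuous_tailPoint {I : Fin (m + 1) → Set ℝ} :
    Continuous (tailPoint : rect I → tailRect I) :=
  Continuous.subtype_mk (continuous_pi fun k => (continuous_apply k.succ).comp
    continuous_subtype_val) _

/-- The point `(t, ξ)` of `K₁ × K₂`. -/
def consPoint {I : Fin (m + 1) → Set ℝ} {t : ℝ} (ht : t ∈ I 0) (ξ : tailRect I) : rect I :=
  ⟨Fin.cons t ξ.1, fun k _ => by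
    refine Fin.cases ?_ (fun i => ?_) k
    · simpa using ht
    · simpa using ξ.2 i (mem_univ _)⟩

theorem consPoint_zero {I : Fin (m + 1) → Set ℝ} {t : ℝ} (ht : t ∈ I 0) (ξ : tailRect I) :
    (consPoint ht ξ).1 0 = t := rfl

theorem tailPoint_consPoint {I : Fin (m + 1) → Set ℝ} {t : ℝ} (ht : t ∈ I 0) (ξ : tailRect I) :
    tailPoint (consPoint ht ξ) = ξ := rfl

/-! ### Maximizers of step functions -/

/-- The points of `K` in every neighbourhood of which `f` has the same supremum as on `K`. -/
def nearMaxSet {ι : Type*} {T : Set (ι → ℝ)} (f : T → ℝ) : Set (ι → ℝ) :=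
  {x | x ∈ T ∧ ∀ U, IsOpen U → x ∈ U → ∀ c : ℝ, (∃ y, c < f y) → ∃ y : T, y.1 ∈ U ∧ c < f y}

/-- The converse, `StepData.isMaximizer_of_mem_nearMaxSet`, needs the form of `f`: in general the
values on the upper faces of `T` are not limits along quadrants. -/
theorem IsMaximizer.mem_nearMaxSet {d : ℕ} {T : Set (Fin d → ℝ)} {f : Space T} {x : T}
    (h : IsMaximizer f x) : x.1 ∈ nearMaxSet f := by
  refine ⟨x.2, fun U hU hxU c ⟨y, hy⟩ => ?_⟩
  obtain ⟨M, hM, h⟩ := h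
  have hc : c < M := hy.trans_le (hM.1 ⟨y, rfl⟩)
  rcases h with h | ⟨ρ, hne, h⟩
  · exact ⟨x, hxU, h ▸ hc⟩
  · have := hne
    have h1 : ∀ᶠ y in 𝓝[quadrant ρ x] x, c < f y := h.eventually (lt_mem_nhds hc)
    have h2 : ∀ᶠ y in 𝓝[quadrant ρ x] x, y.1 ∈ U :=
      nhdsWithin_le_nhds ((hU.preimage continuous_subtype_val).mem_nhds hxU)
    obtain ⟨y, hy⟩ := (h2.and h1).exists
    exact ⟨y, hy⟩

/-- Where the maximum is approached, it is either the value of `f`, or the value of the function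
that is active immediately to the left. -/
theorem StepData.eq_or_left_eq {I : Fin (m + 1) → Set ℝ} {ψ : rect I → ℝ} {γ : line (I 0) → ℝ}
    {κ : ℝ → ℤ} {V : ℤ → tailRect I → ℝ} (h : StepData ψ γ κ V) (hI : (I 0).OrdConnected)
    {M : ℝ} (hM : IsLUB (range ψ) M) {x : rect I} (hx : x.1 ∈ nearMaxSet ψ) :
    ψ x = M ∨ ∃ j, (∀ᶠ s in 𝓝[<] (x.1 0), κ s = j) ∧ V j (tailPoint x) = M ∧
      ∃ s ∈ I 0, s < x.1 0 := by
  have key : ∀ (c : ℝ), c < M → ∃ᶠ y in 𝓝 x, c < ψ y := by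
    intro c hc
    obtain ⟨_, ⟨y, rfl⟩, hy⟩ := (lt_isLUB_iff hM).1 hc
    rw [frequently_nhds_iff]
    intro U hU hUo
    obtain ⟨U', hU', rfl⟩ := isOpen_induced_iff.1 hUo
    obtain ⟨z, hz⟩ := hx.2 U' hU' hU c ⟨y, hy⟩
    exact ⟨z, hz⟩
  have hcoord : Tendsto (fun y : rect I => y.1 0) (𝓝 x) (𝓝 (x.1 0)) :=
    ((continuous_apply 0).comp continuous_subtype_val).tendsto x
  obtain ⟨j, hj⟩ := exists_eventually_eq_nhdsLT h.monotone (x.1 0)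
  have hright := h.right (x.1 0)
  by_contra hcon
  rw [not_or] at hcon
  have h1 : V (κ (x.1 0)) (tailPoint x) < M := by
    rw [← h.apply_eq]
    exact lt_of_le_of_ne (hM.1 ⟨x, rfl⟩) hcon.1
  have hnear : ∀ i, V i (tailPoint x) < M →
      ∃ c < M, ∀ᶠ y in 𝓝 x, V i (tailPoint y) < c := fun i hi => by
    obtain ⟨c, hc1, hc2⟩ := exists_between hi
    exact ⟨c, hc2, (((h.continuous i).comp continuous_tailPoint).tendsto x).eventually
      (gt_mem_nhds hc1)⟩
  obtain ⟨c, hc, hc'⟩ := hnear _ h1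
  have hright' : ∀ᶠ y in 𝓝 x, x.1 0 ≤ y.1 0 → κ (y.1 0) = κ (x.1 0) :=
    hcoord.eventually (eventually_nhdsWithin_iff.1 hright)
  have hleft' : ∀ᶠ y in 𝓝 x, y.1 0 < x.1 0 → κ (y.1 0) = j :=
    hcoord.eventually (eventually_nhdsWithin_iff.1 hj)
  by_cases hs : ∃ s ∈ I 0, s < x.1 0
  · have hle : V j (tailPoint x) ≤ M := by
      obtain ⟨s, hsI, hs⟩ := hs
      obtain ⟨r, hr, hr'⟩ := (hj.and (Ioo_mem_nhdsLT hs)).exists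
      have := hM.1 ⟨consPoint (hI.out hsI (x.2 0 (mem_univ _)) ⟨hr'.1.le, hr'.2.le⟩)
        (tailPoint x), rfl⟩
      rwa [h.apply_eq, consPoint_zero, tailPoint_consPoint, hr] at this
    have h2 : V j (tailPoint x) < M :=
      lt_of_le_of_ne hle fun he => hcon.2 ⟨j, hj, he, hs⟩
    obtain ⟨c', hc2, hc2'⟩ := hnear _ h2
    refine key (max c c') (max_lt hc hc2) ?_
    filter_upwards [hc', hc2', hright', hleft'] with y y1 y2 y3 y4
    rw [not_lt, h.apply_eq]
    rcases le_or_gt (x.1 0) (y.1 0) with hxy | hxy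
    · rw [y3 hxy]
      exact y1.le.trans (le_max_left _ _)
    · rw [y4 hxy]
      exact y2.le.trans (le_max_right _ _)
  · push Not at hs
    refine key c hc ?_
    filter_upwards [hc', hright'] with y y1 y3
    rw [not_lt, h.apply_eq, y3 (hs _ (y.2 0 (mem_univ _)))]
    exact y1.le

/-- A point of a product of nondegenerate intervals is the vertex of a nonempty quadrant that goes
down along the `i`-th coordinate, provided that the `i`-th interval has smaller points. -/
theorem exists_quadrant_neBot {ι : Type*} {I : ι → Set ℝ}
    (hI : ∀ k, IsClosedInterval (I k)) (x : rect I) {i : ι} {s : ℝ} (hs : s ∈ I i)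
    (hsx : s < x.1 i) :
    ∃ ρ : ι → Bool, ρ i = false ∧ (𝓝[quadrant ρ x] x).NeBot := by
  classical
  have hne : ∀ k, ∃ y ∈ I k, y ≠ x.1 k := fun k => (hI k).nontrivial.exists_ne _
  choose y' hy'I hy'ne using hne
  let y : ι → ℝ := Function.update y' i s
  have hyI : ∀ k, y k ∈ I k := fun k => by
    by_cases hk : k = i
    · subst hk; simpa [y] using hs
    · simpa [y, hk] using hy'I k
  have hyne : ∀ k, y k ≠ x.1 k := fun k => by
    by_cases hk : k = i
    · subst hk; simpa [y] using hsx.ne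
    · simpa [y, hk] using hy'ne k
  refine ⟨fun k => decide (x.1 k < y k), by simp [y, hsx.le], ?_⟩
  rw [← mem_closure_iff_nhdsWithin_neBot]
  have hmem : ∀ e ∈ Ioc (0 : ℝ) 1, (fun k => x.1 k + e * (y k - x.1 k)) ∈ rect I := by
    intro e he k _
    have hx := x.2 k (mem_univ _)
    rcases le_total (x.1 k) (y k) with hxy | hxy
    · exact (hI k).ordConnected.out hx (hyI k) ⟨by nlinarith [he.1], by nlinarith [he.2]⟩
    · exact (hI k).ordConnected.out (hyI k) hx ⟨by nlinarith [he.2], by nlinarith [he.1]⟩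
  let z : ℕ → rect I := fun n =>
    ⟨_, hmem (1 / ((n : ℝ) + 1)) ⟨by positivity, by
      rw [div_le_one (by positivity)]; linarith [n.cast_nonneg (α := ℝ)]⟩⟩
  refine mem_closure_of_tendsto (f := z) (b := atTop) ?_ (Eventually.of_forall fun n k => ?_)
  · rw [tendsto_subtype_rng, tendsto_pi_nhds]
    intro k
    have h0 : Tendsto (fun n : ℕ => 1 / ((n : ℝ) + 1)) atTop (𝓝 0) :=
      tendsto_one_div_add_atTop_nhds_zero_nat
    have h1 := (h0.mul_const (y k - x.1 k)).const_add (x.1 k)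
    rwa [zero_mul, add_zero] at h1
  · have he : (0 : ℝ) < 1 / ((n : ℝ) + 1) := by positivity
    rcases lt_or_gt_of_ne (hyne k) with hk | hk
    · simp only [hk.not_gt, decide_false, Bool.false_eq_true, if_false]
      change x.1 k + 1 / ((n : ℝ) + 1) * (y k - x.1 k) < x.1 k
      nlinarith
    · simp only [hk, decide_true, if_true]
      change x.1 k < x.1 k + 1 / ((n : ℝ) + 1) * (y k - x.1 k)
      nlinarith

theorem StepData.isMaximizer_of_mem_nearMaxSet {I : Fin (m + 1) → Set ℝ} {ψ : Space (rect I)}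
    {γ : line (I 0) → ℝ} {κ : ℝ → ℤ} {V : ℤ → tailRect I → ℝ} (h : StepData ψ γ κ V)
    (hI : ∀ k, IsClosedInterval (I k)) {M : ℝ} (hM : IsLUB (range ψ) M) {x : rect I}
    (hx : x.1 ∈ nearMaxSet ψ) : IsMaximizer ψ x := by
  refine ⟨M, hM, ?_⟩
  rcases h.eq_or_left_eq (hI 0).ordConnected hM hx with h1 | ⟨j, hj, hV, s, hsI, hs⟩
  · exact Or.inl h1
  obtain ⟨ρ, hρ, hne⟩ := exists_quadrant_neBot hI x hsI hs
  refine Or.inr ⟨ρ, hne, ?_⟩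
  have hlim : Tendsto (fun y => V j (tailPoint y)) (𝓝[quadrant ρ x] x) (𝓝 M) := by
    rw [← hV]
    exact (((h.continuous j).comp continuous_tailPoint).tendsto x).mono_left nhdsWithin_le_nhds
  refine hlim.congr' ?_
  have hcoord : Tendsto (fun y : rect I => y.1 0) (𝓝 x) (𝓝 (x.1 0)) :=
    ((continuous_apply 0).comp continuous_subtype_val).tendsto x
  filter_upwards [nhdsWithin_le_nhds (hcoord.eventually (eventually_nhdsWithin_iff.1 hj)),
    self_mem_nhdsWithin] with y hy hyq
  have hy0 := hyq 0
  simp only [hρ, Bool.false_eq_true, if_false] at hy0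
  rw [h.apply_eq, hy hy0]

theorem isMaximizer_of_isLUB {d : ℕ} {T : Set (Fin d → ℝ)} {f : Space T} {x : T}
    (h : IsLUB (range f) (f x)) : IsMaximizer f x := ⟨_, h, Or.inl rfl⟩

theorem isClosed_nearMaxSet {ι : Type*} {T : Set (ι → ℝ)} (hT : IsClosed T) (f : T → ℝ) :
    IsClosed (nearMaxSet f) := by
  refine isClosed_of_closure_subset fun x hx => ⟨?_, fun U hU hxU c hc => ?_⟩
  · exact hT.closure_subset_iff.2 (fun y hy => hy.1) hx
  · obtain ⟨y, hyU, hy⟩ := mem_closure_iff.1 hx U hU hxU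
    exact hy.2 U hU hyU c hc

/-- A compact set meets `nearMaxSet f` as soon as `f` is nearly maximal somewhere near it. -/
theorem nearMaxSet_inter_nonempty_iff {ι : Type*} [Fintype ι] {T : Set (ι → ℝ)} (hT : IsClosed T)
    {f : T → ℝ} {M : ℝ} (hM : IsLUB (range f) M) {C : Set (ι → ℝ)} (hC : IsCompact C) :
    (nearMaxSet f ∩ C).Nonempty ↔ ∀ (n : ℕ) (c : ℚ), (∃ y, (c : ℝ) < f y) →
      ∃ y : T, y.1 ∈ Metric.thickening (1 / ((n : ℝ) + 1)) C ∧ (c : ℝ) < f y := by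
  constructor
  · rintro ⟨x, hx, hxC⟩ n c hc
    exact hx.2 _ Metric.isOpen_thickening
      (Metric.self_subset_thickening (by positivity) C hxC) c hc
  · intro h
    by_contra hne
    have hloc : ∀ x ∈ C, ∃ U, IsOpen U ∧ x ∈ U ∧ ∃ c < M, ∀ y : T, y.1 ∈ U → f y ≤ c := by
      intro x hx
      by_cases hxT : x ∈ T
      · have hx' : x ∉ nearMaxSet f := fun h' => hne ⟨x, h', hx⟩
        simp only [nearMaxSet, mem_ofPred_eq, hxT, true_and] at hx'
        push Not at hx'
        obtain ⟨U, hU, hxU, c, ⟨y, hy⟩, hc⟩ := hx'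
        exact ⟨U, hU, hxU, c, hy.trans_le (hM.1 ⟨y, rfl⟩), hc⟩
      · exact ⟨Tᶜ, hT.isOpen_compl, hxT, M - 1, by linarith, fun y hy => absurd y.2 hy⟩
    have hglob : ∃ U, IsOpen U ∧ C ⊆ U ∧ ∃ c < M, ∀ y : T, y.1 ∈ U → f y ≤ c := by
      refine hC.induction_on (p := fun C => ∃ U, IsOpen U ∧ C ⊆ U ∧ ∃ c < M,
        ∀ y : T, y.1 ∈ U → f y ≤ c) ?_ ?_ ?_ ?_
      · exact ⟨∅, isOpen_empty, Subset.rfl, M - 1, by linarith, fun y hy => hy.elim⟩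
      · rintro s t hst ⟨U, hU, htU, hc⟩
        exact ⟨U, hU, hst.trans htU, hc⟩
      · rintro s t ⟨U, hU, hsU, c, hc, hb⟩ ⟨U', hU', hsU', c', hc', hb'⟩
        refine ⟨U ∪ U', hU.union hU', union_subset_union hsU hsU', max c c', max_lt hc hc',
          fun y hy => ?_⟩
        rcases hy with hy | hy
        · exact (hb y hy).trans (le_max_left _ _)
        · exact (hb' y hy).trans (le_max_right _ _)
      · intro x hx
        obtain ⟨U, hU, hxU, hc⟩ := hloc x hx
        exact ⟨U, mem_nhdsWithin_of_mem_nhds (hU.mem_nhds hxU), U, hU, Subset.rfl, hc⟩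
    obtain ⟨U, hU, hCU, c, hc, hb⟩ := hglob
    obtain ⟨e, he, hthick⟩ := hC.exists_thickening_subset_open hU hCU
    obtain ⟨n, hn⟩ := exists_nat_one_div_lt he
    obtain ⟨r, hr1, hr2⟩ := exists_rat_btwn hc
    obtain ⟨_, ⟨y, rfl⟩, hy⟩ := (lt_isLUB_iff hM).1 hr2
    obtain ⟨z, hz, hz'⟩ := h n r ⟨y, hy⟩
    have := hb z (hthick (Metric.thickening_mono hn.le C hz))
    linarith

end StepFunctions

/-! ### Measurability of the lexicographic minimum of a random closed set -/

section Lexicographic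

variable {Ω : Type*} [MeasurableSpace Ω] {P : Measure Ω} {d : ℕ}
  {A : Ω → Set (Fin d → ℝ)} {s : Ω → Fin d → ℝ}

/-- If the first `k` coordinates of the points of `A` are already minimized by those of `s`, then
`s k ≤ c` means that a point of `A` with these coordinates lies in the half-space `x k ≤ c`. -/
theorem aemeasurable_apply_of_nullMeasurableSet_hit (k : Fin d)
    (hs : ∀ᵐ ω ∂P, s ω ∈ A ω ∧ ∀ y ∈ A ω, ∀ k, (∀ j, j < k → s ω j = y j) → s ω k ≤ y k)
    (hhit : ∀ C, IsCompact C → NullMeasurableSet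
      {ω | ∃ x ∈ A ω ∩ C, ∀ j, j < k → s ω j = x j} P) :
    AEMeasurable (fun ω => s ω k) P := by
  refine NullMeasurable.aemeasurable ?_
  refine @measurable_of_Iic ℝ (NullMeasurableSpace Ω P) _ _ _ _ _ _ _ _ fun c => ?_
  change NullMeasurableSet ((fun ω => s ω k) ⁻¹' Iic c) P
  have hC : ∀ N : ℕ, IsCompact (Metric.closedBall (0 : Fin d → ℝ) N ∩ {x | x k ≤ c}) := fun N =>
    (isCompact_closedBall _ _).inter_right (isClosed_le (continuous_apply k) continuous_const)
  refine (NullMeasurableSet.iUnion fun N : ℕ => hhit _ (hC N)).congr ?_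
  rw [eventuallyEq_set]
  filter_upwards [hs] with ω hω
  simp only [mem_iUnion, mem_ofPred_eq, mem_preimage, mem_Iic]
  constructor
  · rintro ⟨N, x, ⟨hxA, -, hxc⟩, hx⟩
    exact (hω.2 x hxA k hx).trans hxc
  · intro h
    obtain ⟨N, hN⟩ := exists_nat_ge ‖s ω‖
    exact ⟨N, s ω, ⟨hω.1, by simpa using hN, h⟩, fun j _ => rfl⟩

theorem nullMeasurableSet_hit_of_lexicographic (hA : ∀ᵐ ω ∂P, IsClosed (A ω))
    (hs : ∀ᵐ ω ∂P, s ω ∈ A ω ∧ ∀ y ∈ A ω, ∀ k, (∀ j, j < k → s ω j = y j) → s ω k ≤ y k)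
    (hhit : ∀ C, IsCompact C → NullMeasurableSet {ω | (A ω ∩ C).Nonempty} P) (k : ℕ)
    (hk : k ≤ d) : ∀ C, IsCompact C → NullMeasurableSet
      {ω | ∃ x ∈ A ω ∩ C, ∀ j : Fin d, (j : ℕ) < k → s ω j = x j} P := by
  induction k with
  | zero =>
    intro C hC
    convert hhit C hC using 3
    simp [Set.Nonempty]
  | succ k ih =>
    intro C hC
    have ih := ih (by omega)
    let i : Fin d := ⟨k, hk⟩
    have hsi : AEMeasurable (fun ω => s ω i) P :=
      aemeasurable_apply_of_nullMeasurableSet_hit i hs ih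
    have hr : ∀ r : ℚ, NullMeasurableSet ({ω | s ω i < r}ᶜ ∪
        {ω | ∃ x ∈ A ω ∩ (C ∩ {x | x i ≤ r}), ∀ j : Fin d, (j : ℕ) < k → s ω j = x j}) P :=
      fun r => ((nullMeasurableSet_lt hsi aemeasurable_const).compl).union
        (ih _ (hC.inter_right (isClosed_le (continuous_apply i) continuous_const)))
    refine (NullMeasurableSet.iInter hr).congr ?_
    rw [eventuallyEq_set]
    filter_upwards [hs, hA] with ω hω hAω
    simp only [mem_iInter, mem_union, mem_compl_iff, mem_ofPred_eq, ← imp_iff_not_or]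
    constructor
    · intro h
      -- By compactness, the half-spaces `x i ≤ r` may be replaced by their intersection.
      let t : {r : ℚ // s ω i < r} → Set (Fin d → ℝ) := fun r =>
        ((A ω ∩ C) ∩ {x | ∀ j : Fin d, (j : ℕ) < k → s ω j = x j}) ∩ {x | x i ≤ (r.1 : ℝ)}
      have hcl : IsClosed {x : Fin d → ℝ | ∀ j : Fin d, (j : ℕ) < k → s ω j = x j} := by
        simp only [ofPred_forall]
        exact isClosed_iInter fun j => isClosed_iInter fun _ =>
          isClosed_eq continuous_const (continuous_apply j)
      have hcomp : ∀ r, IsCompact (t r) := fun r =>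
        ((hC.inter_left hAω).inter_right hcl).inter_right
          (isClosed_le (continuous_apply i) continuous_const)
      have : Nonempty {r : ℚ // s ω i < r} := by
        obtain ⟨r, hr⟩ := exists_rat_gt (s ω i)
        exact ⟨⟨r, hr⟩⟩
      have hne := IsCompact.nonempty_iInter_of_directed_nonempty_isCompact_isClosed t ?_ ?_ hcomp
        fun r => (hcomp r).isClosed
      · obtain ⟨x, hx⟩ := hne
        rw [mem_iInter] at hx
        obtain ⟨r₀, hr₀⟩ := exists_rat_gt (s ω i)
        have hx0 := (hx ⟨r₀, hr₀⟩).1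
        have hle : x i ≤ s ω i := by
          by_contra hlt
          obtain ⟨r, hr1, hr2⟩ := exists_rat_btwn (not_le.1 hlt)
          exact absurd (hx ⟨r, hr1⟩).2 (not_le.2 hr2)
        have hge := hω.2 x hx0.1.1 i fun j hj => hx0.2 j hj
        refine ⟨x, hx0.1, fun j hj => ?_⟩
        rcases (Nat.lt_succ_iff.1 hj).lt_or_eq with hj | hj
        · exact hx0.2 j hj
        · obtain rfl : j = i := Fin.ext hj
          exact le_antisymm hge hle
      · intro r r'
        refine ⟨⟨min r.1 r'.1, by push_cast; exact lt_min r.2 r'.2⟩, fun x hx => ?_, fun x hx => ?_⟩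
        · refine ⟨hx.1, (show x i ≤ _ from hx.2).trans ?_⟩
          exact_mod_cast min_le_left _ _
        · refine ⟨hx.1, (show x i ≤ _ from hx.2).trans ?_⟩
          exact_mod_cast min_le_right _ _
      · rintro ⟨r, hr⟩
        obtain ⟨x, ⟨hxA, hxC, hxr⟩, hx⟩ := h r hr
        exact ⟨x, ⟨⟨hxA, hxC⟩, hx⟩, hxr⟩
    · rintro ⟨x, ⟨hxA, hxC⟩, hx⟩ r hr
      exact ⟨x, ⟨hxA, hxC, (hx i (Nat.lt_succ_self k)).symm.le.trans hr.le⟩,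
        fun j hj => hx j (hj.trans (Nat.lt_succ_self k))⟩

/-- The lexicographically smallest element of a random closed set is measurable, if the set hits
every compact set on a measurable event. -/
theorem aemeasurable_of_lexicographic_least (hA : ∀ᵐ ω ∂P, IsClosed (A ω))
    (hs : ∀ᵐ ω ∂P, s ω ∈ A ω ∧ ∀ y ∈ A ω, ∀ k, (∀ j, j < k → s ω j = y j) → s ω k ≤ y k)
    (hhit : ∀ C, IsCompact C → NullMeasurableSet {ω | (A ω ∩ C).Nonempty} P) :
    AEMeasurable s P :=
  aemeasurable_pi_iff.2 fun k => aemeasurable_apply_of_nullMeasurableSet_hit k hs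
    (nullMeasurableSet_hit_of_lexicographic hA hs hhit k k.2.le)

theorem aemeasurable_of_lexicographic_greatest (hA : ∀ᵐ ω ∂P, IsClosed (A ω))
    (hs : ∀ᵐ ω ∂P, s ω ∈ A ω ∧ ∀ y ∈ A ω, ∀ k, (∀ j, j < k → s ω j = y j) → y k ≤ s ω k)
    (hhit : ∀ C, IsCompact C → NullMeasurableSet {ω | (A ω ∩ C).Nonempty} P) :
    AEMeasurable s P := by
  have h : AEMeasurable (fun ω => -s ω) P := by
    refine aemeasurable_of_lexicographic_least (A := fun ω => -A ω) ?_ ?_ ?_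
    · filter_upwards [hA] with ω hω using hω.neg
    · filter_upwards [hs] with ω hω
      refine ⟨by simpa using hω.1, fun y hy k hk => ?_⟩
      have := hω.2 (-y) hy k fun j hj => by simp [← hk j hj]
      simp only [Pi.neg_apply] at this ⊢
      linarith
    · intro C hC
      convert hhit (-C) hC.neg using 3 with ω
      rw [← Set.nonempty_neg, Set.inter_neg, neg_neg]
  exact h.neg.congr (Eventually.of_forall fun ω => neg_neg (s ω))

end Lexicographic

/-! ### Measurability of the extreme maximizers -/

theorem IsSargmax.sargmax_eq {d : ℕ} {T : Set (Fin d → ℝ)} {f : Space T} {x : T}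
    (h : IsSargmax f x) : sargmax f = x.1 := by
  have hex : ∃ x, IsSargmax f x := ⟨x, h⟩
  rw [sargmax, dif_pos hex, hex.choose_spec.unique h]

theorem IsLargmax.largmax_eq {d : ℕ} {T : Set (Fin d → ℝ)} {f : Space T} {x : T}
    (h : IsLargmax f x) : largmax f = x.1 := by
  have hex : ∃ x, IsLargmax f x := ⟨x, h⟩
  rw [largmax, dif_pos hex, hex.choose_spec.unique h]

/-- A nondegenerate closed interval meets every large enough `[-M, M]` in a nondegenerate compact
interval. -/
theorem IsClosedInterval.exists_inter_eq_Icc {J : Set ℝ} (hJ : IsClosedInterval J) :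
    ∀ᶠ M : ℝ in atTop, ∃ a b, a < b ∧ J ∩ Icc (-M) M = Icc a b := by
  obtain ⟨x, hx, y, hy, hxy⟩ := hJ.nontrivial.exists_lt
  filter_upwards [eventually_ge_atTop |x|, eventually_ge_atTop |y|] with M hMx hMy
  have hx' : x ∈ J ∩ Icc (-M) M := ⟨hx, abs_le.1 hMx⟩
  have hy' : y ∈ J ∩ Icc (-M) M := ⟨hy, abs_le.1 hMy⟩
  have hc : IsCompact (J ∩ Icc (-M) M) := isCompact_Icc.inter_left hJ.isClosed
  have h := eq_Icc_of_connected_compact ⟨⟨x, hx'⟩,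
    (hJ.ordConnected.inter ordConnected_Icc).isPreconnected⟩ hc
  refine ⟨_, _, ?_, h⟩
  rw [h] at hx' hy'
  exact (hx'.1.trans_lt hxy).trans_le hy'.2

/-- `[p, q]` is the part of `∏ I k` in the cube `[-M, M]^ι`. -/
def IsTruncation {ι : Type*} (I : ι → Set ℝ) (M : ℝ) (p q : ι → ℝ) : Prop :=
  ∀ k, p k < q k ∧ I k ∩ Icc (-M) M = Icc (p k) (q k)

theorem exists_isTruncation {ι : Type*} [Finite ι] {I : ι → Set ℝ}
    (hI : ∀ k, IsClosedInterval (I k)) : ∀ᶠ M : ℝ in atTop, ∃ p q, IsTruncation I M p q := by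
  filter_upwards [eventually_all.2 fun k => (hI k).exists_inter_eq_Icc] with M h
  choose p q h using h
  exact ⟨p, q, h⟩

theorem IsTruncation.mem_Icc_iff {ι : Type*} {I : ι → Set ℝ} {M : ℝ} {p q : ι → ℝ}
    (h : IsTruncation I M p q) {x : ι → ℝ} :
    x ∈ Icc p q ↔ x ∈ rect I ∧ ∀ k, |x k| ≤ M := by
  simp only [Set.mem_pi, mem_univ, true_imp_iff, ← forall_and, abs_le, mem_Icc, Pi.le_def]
  refine forall_congr' fun k => ?_
  exact (Set.ext_iff.1 (h k).2 (x k)).symm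

theorem IsTruncation.subset {ι : Type*} {I : ι → Set ℝ} {M : ℝ} {p q : ι → ℝ}
    (h : IsTruncation I M p q) : Icc p q ⊆ rect I := fun _ hx => (h.mem_Icc_iff.1 hx).1

section Maximizers

variable {m : ℕ} {Ω : Type*} [MeasurableSpace Ω] {P : Measure Ω} {I : Fin (m + 1) → Set ℝ}

/-- The event that `ψ` exceeds `c` somewhere in an open set is a countable union of preimages of
open sets of the Skorohod spaces over compact rectangles. -/
theorem nullMeasurableSet_exists_lt (hI : ∀ k, IsClosedInterval (I k))
    {ψ : Ω → Space (rect I)} {γ : Ω → Space (line (I 0))}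
    (hmeas : ∀ (p q : Fin (m + 1) → ℝ) (hpq : ∀ k, p k < q k) (hsub : Icc p q ⊆ rect I),
      AEMeasurable (fun ω => restrictPair (fun k => (hpq k).le) hsub (ψ ω) (γ ω)) P)
    {U : Set (Fin (m + 1) → ℝ)} (hU : IsOpen U) (c : ℝ) :
    NullMeasurableSet {ω | ∃ y : rect I, y.1 ∈ U ∧ c < ψ ω y} P := by
  obtain ⟨M₀, hM₀⟩ := eventually_atTop.1 (exists_isTruncation hI)
  choose p q hT using fun N : ℕ => hM₀ (max M₀ N) (le_max_left _ _)
  have hN : ∀ N, NullMeasurableSet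
      ((fun ω => restrictPair (fun k => (hT N k).1.le) (hT N).subset (ψ ω) (γ ω)) ⁻¹'
        {f : JointSpace (p N) (q N) | ∃ y : Icc (p N) (q N), y.1 ∈ U ∧ c < f.1 y}) P := fun N =>
    (hmeas (p N) (q N) (fun k => (hT N k).1) (hT N).subset).nullMeasurable
      (show IsOpen {f : JointSpace (p N) (q N) | ∃ y : Icc (p N) (q N), y.1 ∈ U ∧ c < f.1 y} from
        (isOpen_setOf_exists_lt hU c).preimage continuous_fst).measurableSet
  convert NullMeasurableSet.iUnion hN using 1
  ext ω
  simp only [mem_iUnion, mem_preimage, mem_ofPred_eq]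
  constructor
  · rintro ⟨y, hyU, hy⟩
    obtain ⟨N, hN⟩ := exists_nat_ge ‖y.1‖
    refine ⟨N, ⟨y.1, (hT N).mem_Icc_iff.2 ⟨y.2, fun k => ?_⟩⟩, hyU, hy⟩
    exact ((norm_le_pi_norm y.1 k).trans hN).trans (le_max_right _ _)
  · rintro ⟨N, y, hyU, hy⟩
    exact ⟨⟨y.1, (hT N).subset y.2⟩, hyU, hy⟩

theorem aemeasurable_sargmax_largmax (hI : ∀ k, IsClosedInterval (I k))
    {ψ : Ω → Space (rect I)} {γ : Ω → Space (line (I 0))}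
    (hstep : ∀ᵐ ω ∂P, ∃ κ V, StepData (ψ ω) (γ ω) κ V)
    (hdef : ∀ᵐ ω ∂P, ArgmaxDefined (ψ ω))
    (hmeas : ∀ (p q : Fin (m + 1) → ℝ) (hpq : ∀ k, p k < q k) (hsub : Icc p q ⊆ rect I),
      AEMeasurable (fun ω => restrictPair (fun k => (hpq k).le) hsub (ψ ω) (γ ω)) P) :
    AEMeasurable (fun ω => (sargmax (ψ ω), largmax (ψ ω))) P := by
  have hclosed : IsClosed (rect I) := isClosed_set_pi fun k _ => (hI k).isClosed
  have hA : ∀ᵐ ω ∂P, IsClosed (nearMaxSet (ψ ω)) :=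
    Eventually.of_forall fun ω => isClosed_nearMaxSet hclosed _
  have hhit : ∀ C, IsCompact C → NullMeasurableSet {ω | (nearMaxSet (ψ ω) ∩ C).Nonempty} P := by
    intro C hC
    have h : NullMeasurableSet (⋂ (n : ℕ) (c : ℚ),
        ({ω | ∃ y : rect I, y.1 ∈ (univ : Set (Fin (m + 1) → ℝ)) ∧ (c : ℝ) < ψ ω y}ᶜ ∪
        {ω | ∃ y : rect I, y.1 ∈ Metric.thickening (1 / ((n : ℝ) + 1)) C ∧ (c : ℝ) < ψ ω y})) P :=
      NullMeasurableSet.iInter fun n => NullMeasurableSet.iInter fun c =>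
        (nullMeasurableSet_exists_lt hI hmeas isOpen_univ c).compl.union
          (nullMeasurableSet_exists_lt hI hmeas Metric.isOpen_thickening c)
    refine h.congr ?_
    rw [eventuallyEq_set]
    filter_upwards [hdef] with ω hω
    obtain ⟨⟨x, ⟨M, hM, -⟩, -⟩, -⟩ := hω
    simp only [mem_iInter, mem_union, mem_compl_iff, mem_ofPred_eq, ← imp_iff_not_or, mem_univ,
      true_and]
    exact (nearMaxSet_inter_nonempty_iff hclosed hM hC).symm
  refine AEMeasurable.prodMk ?_ ?_
  · refine aemeasurable_of_lexicographic_least hA ?_ hhit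
    filter_upwards [hdef, hstep] with ω ⟨⟨x, hx⟩, _⟩ ⟨κ, V, hκ⟩
    obtain ⟨M, hM, -⟩ := hx.1
    rw [hx.sargmax_eq]
    exact ⟨hx.1.mem_nearMaxSet, fun y hy =>
      hx.2 ⟨y, hy.1⟩ (hκ.isMaximizer_of_mem_nearMaxSet hI hM hy)⟩
  · refine aemeasurable_of_lexicographic_greatest hA ?_ hhit
    filter_upwards [hdef, hstep] with ω ⟨_, ⟨x, hx⟩⟩ ⟨κ, V, hκ⟩
    obtain ⟨M, hM, -⟩ := hx.1
    rw [hx.largmax_eq]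
    exact ⟨hx.1.mem_nearMaxSet, fun y hy =>
      hx.2 ⟨y, hy.1⟩ (hκ.isMaximizer_of_mem_nearMaxSet hI hM hy)⟩

end Maximizers

section Stability

variable {m : ℕ} {I : Fin (m + 1) → Set ℝ}

/-! ### The maximum of the limit -/

theorem StepData.eventually_eq_of_continuousAt {ψ : rect I → ℝ} {γ : line (I 0) → ℝ}
    {κ : ℝ → ℤ} {V : ℤ → tailRect I → ℝ} (h : StepData ψ γ κ V) (hI : (I 0).OrdConnected)
    {t : ℝ} (ht : t ∈ I 0) (hc : ContinuousAt γ ⟨fun _ => t, fun _ _ => ht⟩) :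
    ∀ᶠ s in 𝓝 t, s ∈ I 0 → κ s = κ t := by
  obtain ⟨e, he, hball⟩ := Metric.continuousAt_iff.1 hc 1 one_pos
  have habs : ∀ s ∈ I 0, |s - t| < e → |(κ s : ℝ)| = |(κ t : ℝ)| := by
    intro s hs hst
    have h1 := hball (x := ⟨fun _ => s, fun _ _ => hs⟩) (by
      rw [Subtype.dist_eq, dist_pi_lt_iff he]
      exact fun _ => hst)
    rw [h.jumps_eq, h.jumps_eq, Real.dist_eq] at h1
    have h2 : |(|κ s| - |κ t|)| < 1 := by exact_mod_cast h1
    have h3 : |κ s| = |κ t| := by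
      rw [abs_lt] at h2
      omega
    exact_mod_cast h3
  filter_upwards [Metric.ball_mem_nhds t he] with s hs hsI
  refine (eq_of_forall_abs_eq h.monotone h.zero fun r hr => habs r ?_ ?_).symm
  · exact hI.uIcc_subset ht hsI hr
  · rw [Metric.mem_ball, Real.dist_eq] at hs
    exact (abs_sub_left_of_mem_uIcc hr).trans_lt hs

/-- The functions `V (κ t)`, `t ∈ K₁`, have the maximum `M`, which is attained at `ξ` only, and for
the index `j` only. The times with index `j` form an interval from `a` to `b`, which contains
`a`. -/
structure IsPeak (I : Fin (m + 1) → Set ℝ) (κ : ℝ → ℤ) (V : ℤ → tailRect I → ℝ) (a b : ℝ)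
    (ξ : tailRect I) (j : ℤ) (M : ℝ) : Prop where
  lt : a < b
  index_eq : ∀ t ∈ Ico a b, κ t = j
  mem_Icc : ∀ t ∈ I 0, κ t = j → t ∈ Icc a b
  apply_eq : V j ξ = M
  lt_of_ne : ∀ η, η ≠ ξ → V j η < M
  exists_bound : ∀ t ∈ I 0, κ t ≠ j → ∃ c < M, ∀ η, V (κ t) η ≤ c

theorem UniqueMaxima.exists_bound_of_ne {X : Type*} {V : ℤ → X → ℝ} (hV : UniqueMaxima V)
    {i j : ℤ} (hij : i ≠ j) {M : ℝ} (hi : ∀ η, V i η ≤ M) (hj : ∀ η, V j η ≤ M)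
    (hjM : ∃ ξ, V j ξ = M) : ∃ c < M, ∀ η, V i η ≤ c := by
  obtain ⟨ξ, hξ, -⟩ := hV.1 i
  refine ⟨V i ξ, lt_of_le_of_ne (hi ξ) fun he => hij ?_, hξ⟩
  have hsup : ∀ k, (∀ η, V k η ≤ M) → (∃ ξ, V k ξ = M) → ⨆ η, V k η = M := by
    rintro k hk ⟨ζ, rfl⟩
    exact (show IsLUB (range (V k)) (V k ζ) from
      ⟨by rintro _ ⟨η, rfl⟩; exact hk η, fun b hb => hb ⟨ζ, rfl⟩⟩).csSup_eq ⟨_, ζ, rfl⟩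
  have hsi := hsup i hi ⟨ξ, he⟩
  have hsj := hsup j hj hjM
  have hA : (({i, j} : Finset ℤ).sup' (by simp) fun k => ⨆ η, V k η) = M := by
    rw [Finset.sup'_insert (H := by simp), Finset.sup'_singleton, hsi, hsj, max_self]
  obtain ⟨k, -, hk⟩ := hV.2 {i, j} (by simp)
  rw [hk i ⟨by simp, hA.trans hsi.symm⟩, hk j ⟨by simp, hA.trans hsj.symm⟩]

/-- The maximum of the limit is a peak between the first coordinates of its extreme maximizers.
That `κ` does not jump at the right end of the truncated interval matters only if `K₁` ends there:
it excludes a peak over this single time. -/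
theorem StepData.exists_isPeak {ψ : Space (rect I)} {γ : line (I 0) → ℝ}
    {κ : ℝ → ℤ} {V : ℤ → tailRect I → ℝ} (h : StepData ψ γ κ V)
    (hI : ∀ k, IsClosedInterval (I k)) (hV : UniqueMaxima V) {x y : rect I}
    (hx : IsSargmax ψ x) (hy : IsLargmax ψ y) {M : ℝ} {p q : Fin (m + 1) → ℝ}
    (hT : IsTruncation I M p q) (hxM : ∀ k, |x.1 k| ≤ M)
    (hq : ∀ᶠ s in 𝓝 (q 0), s ∈ I 0 → κ s = κ (q 0)) :
    tailPoint x = tailPoint y ∧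
      ∃ j M₀, IsPeak I κ V (x.1 0) (y.1 0) (tailPoint x) j M₀ := by
  obtain ⟨M₀, hM₀, -⟩ := id hx.1
  have hmem : ∀ z : rect I, z.1 0 ∈ I 0 := fun z => z.2 0 (mem_univ _)
  have hle : ∀ t ∈ I 0, ∀ η, V (κ t) η ≤ M₀ := fun t ht η => by
    have := hM₀.1 ⟨consPoint ht η, rfl⟩
    rwa [h.apply_eq, consPoint_zero, tailPoint_consPoint] at this
  have hattain : ∀ z, IsMaximizer ψ z → ∃ t ∈ I 0, V (κ t) (tailPoint z) = M₀ := by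
    intro z hz
    rcases h.eq_or_left_eq (hI 0).ordConnected hM₀ hz.mem_nearMaxSet with
      h1 | ⟨j, hj, hjz, s, hsI, hs⟩
    · exact ⟨z.1 0, hmem z, by rw [← h.apply_eq, h1]⟩
    · obtain ⟨t, ht1, ht2⟩ := (hj.and (Ioo_mem_nhdsLT hs)).exists
      exact ⟨t, (hI 0).ordConnected.out hsI (hmem z) ⟨ht2.1.le, ht2.2.le⟩, by rw [ht1, hjz]⟩
  obtain ⟨t₁, ht₁, hxV⟩ := hattain x hx.1
  set j := κ t₁ with hjdef
  have hother : ∀ t ∈ I 0, κ t ≠ j → ∃ c < M₀, ∀ η, V (κ t) η ≤ c := fun t ht hne =>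
    hV.exists_bound_of_ne hne (hle t ht) (hle t₁ ht₁) ⟨_, hxV⟩
  have hindex : ∀ t ∈ I 0, ∀ η, V (κ t) η = M₀ → κ t = j := fun t ht η he => by
    by_contra hne
    obtain ⟨c, hc, hc'⟩ := hother t ht hne
    linarith [hc' η]
  have huniq : ∀ η, V j η = M₀ → η = tailPoint x := fun η hη =>
    (hV.1 j).unique (fun ζ => hη ▸ hle t₁ ht₁ ζ) (fun ζ => hxV ▸ hle t₁ ht₁ ζ)
  obtain ⟨t₂, ht₂, hyV⟩ := hattain y hy.1
  rw [hindex t₂ ht₂ _ hyV] at hyV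
  have htail := huniq _ hyV
  have hmax : ∀ t (ht : t ∈ I 0), κ t = j → IsMaximizer ψ (consPoint ht (tailPoint x)) := by
    intro t ht htj
    apply isMaximizer_of_isLUB
    rwa [h.apply_eq, consPoint_zero, tailPoint_consPoint, htj, hxV]
  have hIcc : ∀ t ∈ I 0, κ t = j → t ∈ Icc (x.1 0) (y.1 0) := fun t ht htj =>
    ⟨hx.2 _ (hmax t ht htj) 0 fun k hk => absurd hk (Fin.not_lt_zero k),
      hy.2 _ (hmax t ht htj) 0 fun k hk => absurd hk (Fin.not_lt_zero k)⟩
  -- The index `j` is not active to the left of the smallest maximizer, hence it is active there.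
  have hκx : κ (x.1 0) = j := by
    rcases h.eq_or_left_eq (hI 0).ordConnected hM₀ hx.1.mem_nearMaxSet with
      h1 | ⟨i, hi, hiV, s, hsI, hs⟩
    · exact hindex _ (hmem x) (tailPoint x) (by rw [← h.apply_eq, h1])
    · obtain ⟨t, ht1, ht2⟩ := (hi.and (Ioo_mem_nhdsLT hs)).exists
      have ht := (hI 0).ordConnected.out hsI (hmem x) ⟨ht2.1.le, ht2.2.le⟩
      have htj := hindex t ht (tailPoint x) (by rw [ht1, hiV])
      exact absurd (hIcc t ht htj).1 (not_le.2 ht2.2)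
  have hxy := (hIcc _ (hmem x) hκx).2
  refine ⟨htail.symm, j, M₀, ⟨?_, ?_, hIcc, hxV, ?_, hother⟩⟩
  · refine lt_of_le_of_ne hxy fun he => ?_
    by_cases hs : ∃ s ∈ I 0, x.1 0 < s
    · obtain ⟨s, hsI, hs⟩ := hs
      obtain ⟨r, hr1, hr2⟩ := (((h.right (x.1 0)).filter_mono
        (nhdsWithin_mono _ Ioi_subset_Ici_self)).and (Ioo_mem_nhdsGT hs)).exists
      have hr := (hI 0).ordConnected.out (hmem x) hsI ⟨hr2.1.le, hr2.2.le⟩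
      have := (hIcc r hr (hr1.trans hκx)).2
      linarith [hr2.1]
    · push Not at hs
      have hxq : x.1 0 = q 0 := by
        have h1 : x.1 0 ∈ Icc (p 0) (q 0) :=
          (Set.ext_iff.1 (hT 0).2 _).1 ⟨hmem x, abs_le.1 (hxM 0)⟩
        have h2 : q 0 ∈ I 0 :=
          ((Set.ext_iff.1 (hT 0).2 _).2 (right_mem_Icc.2 (hT 0).1.le)).1
        exact le_antisymm h1.2 (hs _ h2)
      have hp : p 0 ∈ I 0 := ((Set.ext_iff.1 (hT 0).2 _).2 (left_mem_Icc.2 (hT 0).1.le)).1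
      rw [← hxq] at hq
      obtain ⟨r, hr1, hr2⟩ := ((hq.filter_mono nhdsWithin_le_nhds).and
        (Ioo_mem_nhdsLT (hxq ▸ (hT 0).1 : p 0 < x.1 0))).exists
      have hr := (hI 0).ordConnected.out hp (hmem x) ⟨hr2.1.le, hr2.2.le⟩
      exact absurd (hIcc r hr ((hr1 hr).trans hκx)).1 (not_le.2 hr2.2)
  · rintro t ⟨ht1, ht2⟩
    apply le_antisymm _ (hκx ▸ h.monotone ht1)
    rcases h.eq_or_left_eq (hI 0).ordConnected hM₀ hy.1.mem_nearMaxSet with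
      h1 | ⟨i, hi, hiV, s, hsI, hs⟩
    · rw [← hindex _ (hmem y) (tailPoint y) (by rw [← h.apply_eq, h1])]
      exact h.monotone ht2.le
    · obtain ⟨r, hr1, hr2⟩ := (hi.and (Ioo_mem_nhdsLT (max_lt hs ht2))).exists
      have hr := (hI 0).ordConnected.out hsI (hmem y)
        ⟨(le_max_left _ _).trans hr2.1.le, hr2.2.le⟩
      rw [← hindex r hr (tailPoint y) (by rw [hr1, hiV])]
      exact h.monotone ((le_max_right _ _).trans hr2.1.le)
  · exact fun η hη => lt_of_le_of_ne (hle t₁ ht₁ η) fun he => hη (huniq η he)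

theorem isCompact_setOf_abs_le (hI : ∀ k, IsClosedInterval (I k)) (M : ℝ) :
    IsCompact {ξ : tailRect I | ∀ k, |ξ.1 k| ≤ M} := by
  have hcl : IsClosed (tailRect I) := isClosed_set_pi fun k _ => (hI k.succ).isClosed
  have h : IsCompact (Icc (fun _ => -M) (fun _ => M) : Set (Fin m → ℝ)) := isCompact_Icc
  convert hcl.isClosedEmbedding_subtypeVal.isCompact_preimage h using 1
  ext ξ
  simp [abs_le, Pi.le_def, forall_and]

theorem mem_Icc_of_abs_le {κ : ℝ → ℤ} (hκ : Monotone κ) {M t : ℝ} (ht : |t| ≤ M) :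
    κ t ∈ Finset.Icc (κ (-M)) (κ M) :=
  Finset.mem_Icc.2 ⟨hκ (abs_le.1 ht).1, hκ (abs_le.1 ht).2⟩

/-- On a compact rectangle, only points near the peak have nearly maximal values. -/
theorem IsPeak.exists_gap {κ : ℝ → ℤ} {V : ℤ → tailRect I → ℝ} {a b : ℝ} {ξ : tailRect I} {j : ℤ}
    {M₀ : ℝ} (h : IsPeak I κ V a b ξ j M₀) (hI : ∀ k, IsClosedInterval (I k))
    (hκ : Monotone κ) (hV : ∀ k, Continuous (V k)) (M : ℝ) {e : ℝ} (he : 0 < e) :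
    ∃ η > 0, ∀ t ∈ I 0, |t| ≤ M → ∀ ζ : tailRect I, (∀ k, |ζ.1 k| ≤ M) →
      M₀ - η < V (κ t) ζ → κ t = j ∧ dist ζ ξ < e := by
  have key : ∀ i ∈ Finset.Icc (κ (-M)) (κ M), ∀ᶠ η in 𝓝[>] (0 : ℝ), ∀ t ∈ I 0, κ t = i →
      ∀ ζ : tailRect I, (∀ k, |ζ.1 k| ≤ M) → M₀ - η < V i ζ → i = j ∧ dist ζ ξ < e := by
    intro i _
    by_cases hij : i = j
    · subst hij
      have hC : IsCompact ({ζ : tailRect I | ∀ k, |ζ.1 k| ≤ M} ∩ {ζ | e ≤ dist ζ ξ}) :=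
        (isCompact_setOf_abs_le hI M).inter_right
          (isClosed_le continuous_const (continuous_id.dist continuous_const))
      have hbound : ∃ c < M₀, ∀ ζ : tailRect I, (∀ k, |ζ.1 k| ≤ M) → e ≤ dist ζ ξ →
          V i ζ ≤ c := by
        rcases eq_empty_or_nonempty
          ({ζ : tailRect I | ∀ k, |ζ.1 k| ≤ M} ∩ {ζ | e ≤ dist ζ ξ}) with h0 | h0
        · exact ⟨M₀ - 1, by linarith, fun ζ h1 h2 => (h0.subset ⟨h1, h2⟩).elim⟩
        · obtain ⟨z, hz, hzmax⟩ := hC.exists_isMaxOn h0 (hV i).continuousOn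
          refine ⟨V i z, h.lt_of_ne z ?_, fun ζ h1 h2 => hzmax ⟨h1, h2⟩⟩
          rintro rfl
          have := hz.2
          rw [mem_ofPred_eq, dist_self] at this
          linarith
      obtain ⟨c, hc, hc'⟩ := hbound
      filter_upwards [Ioo_mem_nhdsGT (sub_pos.2 hc)] with η hη t _ _ ζ hζ hlt
      refine ⟨rfl, ?_⟩
      by_contra hd
      linarith [hc' ζ hζ (not_lt.1 hd), hη.2]
    · by_cases ht : ∃ t ∈ I 0, κ t = i
      · obtain ⟨t, ht, rfl⟩ := ht
        obtain ⟨c, hc, hc'⟩ := h.exists_bound t ht hij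
        filter_upwards [Ioo_mem_nhdsGT (sub_pos.2 hc)] with η hη s _ _ ζ _ hlt
        linarith [hc' ζ, hη.2]
      · exact Eventually.of_forall fun η t ht' hti => absurd ⟨t, ht', hti⟩ ht
  obtain ⟨η, h1, h2⟩ := (((Filter.eventually_all_finset _).2 key).and self_mem_nhdsWithin).exists
  exact ⟨η, h2, fun t ht htM ζ hζ hlt => h1 (κ t) (mem_Icc_of_abs_le hκ htM) t ht rfl ζ hζ hlt⟩

/-! ### Skorohod neighbourhoods of a step function -/

/-- Every interval of constancy of `κ` in `[p, q]` contains a relative ball; the radius does not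
depend on the interval, since there are finitely many of them. -/
theorem exists_uniform_constancy {κ : ℝ → ℤ} (hκ : Monotone κ)
    (hright : ∀ t, ∀ᶠ s in 𝓝[≥] t, κ s = κ t) {p q : ℝ}
    (hq : ∀ᶠ s in 𝓝 q, s ∈ Icc p q → κ s = κ q) :
    ∃ r > 0, ∀ s ∈ Icc p q, ∃ s' ∈ Icc p q, ∀ t ∈ Icc p q, |t - s'| < r → κ t = κ s := by
  have key : ∀ i ∈ Finset.Icc (κ p) (κ q), ∀ᶠ r in 𝓝[>] (0 : ℝ), ∀ s ∈ Icc p q, κ s = i →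
      ∃ s' ∈ Icc p q, ∀ t ∈ Icc p q, |t - s'| < r → κ t = i := by
    intro i _
    by_cases hs : ∃ s ∈ Icc p q, κ s = i
    · obtain ⟨s, hs, rfl⟩ := hs
      have hball : ∃ s' ∈ Icc p q, ∃ r > 0, ∀ t ∈ Icc p q, |t - s'| < r → κ t = κ s := by
        rcases hs.2.lt_or_eq with hsq | hsq
        · obtain ⟨u, hu, hu'⟩ := (mem_nhdsGE_iff_exists_Ico_subset' hsq).1 (hright s)
          have hu0 : s < min u q := lt_min hu hsq
          refine ⟨(s + min u q) / 2, ⟨by linarith [hs.1], by linarith [min_le_right u q]⟩,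
            (min u q - s) / 2, by linarith, fun t _ ht => hu' ?_⟩
          rw [abs_lt] at ht
          exact ⟨by linarith, by linarith [min_le_left u q]⟩
        · obtain ⟨r, hr, hr'⟩ := Metric.eventually_nhds_iff.1 hq
          exact ⟨q, ⟨hs.1.trans hs.2, le_rfl⟩, r, hr, fun t ht htr => hsq ▸ hr' htr ht⟩
      obtain ⟨s', hs', r, hr, h⟩ := hball
      filter_upwards [Ioo_mem_nhdsGT hr] with r' hr' _ _ _
      exact ⟨s', hs', fun t ht htr => h t ht (htr.trans hr'.2)⟩
    · exact Eventually.of_forall fun r s hs' hsi => absurd ⟨s, hs', hsi⟩ hs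
  obtain ⟨r, h1, h2⟩ := (((Filter.eventually_all_finset _).2 key).and self_mem_nhdsWithin).exists
  exact ⟨r, h2, fun s hs => h1 (κ s) (Finset.mem_Icc.2 ⟨hκ hs.1, hκ hs.2⟩) s hs rfl⟩

theorem exists_uniform_modulus (hI : ∀ k, IsClosedInterval (I k)) {V : ℤ → tailRect I → ℝ}
    (hV : ∀ k, Continuous (V k)) (F : Finset ℤ) (M : ℝ) {e : ℝ} (he : 0 < e) :
    ∃ r > 0, ∀ i ∈ F, ∀ ξ ζ : tailRect I, (∀ k, |ξ.1 k| ≤ M) → (∀ k, |ζ.1 k| ≤ M) →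
      dist ξ ζ < r → |V i ξ - V i ζ| < e := by
  have key : ∀ i ∈ F, ∀ᶠ r in 𝓝[>] (0 : ℝ), ∀ ξ ζ : tailRect I, (∀ k, |ξ.1 k| ≤ M) →
      (∀ k, |ζ.1 k| ≤ M) → dist ξ ζ < r → |V i ξ - V i ζ| < e := by
    intro i _
    obtain ⟨r, hr, h⟩ := Metric.uniformContinuousOn_iff.1
      ((isCompact_setOf_abs_le hI M).uniformContinuousOn_of_continuous (hV i).continuousOn) e he
    filter_upwards [Ioo_mem_nhdsGT hr] with r' hr' ξ ζ hξ hζ hd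
    exact h ξ hξ ζ hζ (hd.trans hr'.2)
  obtain ⟨r, h1, h2⟩ := (((Filter.eventually_all_finset _).2 key).and self_mem_nhdsWithin).exists
  exact ⟨r, h2, h1⟩

/-- Although Skorohod closeness of `(ψ, γ)` to `(ψ₀, γ₀)` in the product topology provides different
time changes for the two components, the time change `l` of the second one serves both: it carries
the jumps of `γ` to those of `γ₀`, because these functions are integer-valued, and `ψ` depends on
the time only through the intervals between those jumps. -/
theorem StepData.exists_timeChange {ψ₀ : Space (rect I)} {γ₀ : Space (line (I 0))} {κ₀ : ℝ → ℤ}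
    {V₀ : ℤ → tailRect I → ℝ} (h₀ : StepData ψ₀ γ₀ κ₀ V₀) (hI : ∀ k, IsClosedInterval (I k))
    {M : ℝ} {p q : Fin (m + 1) → ℝ} (hT : IsTruncation I M p q)
    (hpq : p ≤ q) (hq : ∀ᶠ s in 𝓝 (q 0), s ∈ I 0 → κ₀ s = κ₀ (q 0)) {e : ℝ} (he : 0 < e) :
    ∃ δ : ℝ≥0∞, 0 < δ ∧ ∀ (ψ : Space (rect I)) (γ : Space (line (I 0))) (κ : ℝ → ℤ)
      (V : ℤ → tailRect I → ℝ), StepData ψ γ κ V →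
      edist (ψ.restrict hT.subset) (ψ₀.restrict hT.subset) < δ →
      edist (γ.restrict (Icc_subset_line hpq hT.subset))
        (γ₀.restrict (Icc_subset_line hpq hT.subset)) < δ →
      ∃ l : TimeChange (p 0) (q 0), (∀ t, |(l t : ℝ) - t| < e) ∧
        (∀ s t, κ₀ (l s) = κ₀ (l t) → κ s = κ t) ∧
        ∀ (t : Icc (p 0) (q 0)) (ξ : tailRect I), (∀ k, |ξ.1 k| ≤ M) →
          |V (κ t) ξ - V₀ (κ₀ (l t)) ξ| < e := by
  have hsub : ∀ t ∈ Icc (p 0) (q 0), t ∈ I 0 ∧ |t| ≤ M := fun t ht => by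
    have := (Set.ext_iff.1 (hT 0).2 t).2 ht
    exact ⟨this.1, abs_le.2 this.2⟩
  obtain ⟨r₁, hr₁, hconst⟩ := exists_uniform_constancy h₀.monotone h₀.right
    (hq.mono fun s hs hs' => hs (hsub s hs').1)
  obtain ⟨r₂, hr₂, hmod⟩ := exists_uniform_modulus hI h₀.continuous
    (Finset.Icc (κ₀ (-M)) (κ₀ M)) M (half_pos he)
  let r := min (min (r₁ / 2) r₂) (min (e / 2) 1)
  have hr : 0 < r := lt_min (lt_min (half_pos hr₁) hr₂) (lt_min (half_pos he) one_pos)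
  have hrr₁ : r ≤ r₁ / 2 := (min_le_left _ _).trans (min_le_left _ _)
  have hrr₂ : r ≤ r₂ := (min_le_left _ _).trans (min_le_right _ _)
  have hre : r ≤ e / 2 := (min_le_right _ _).trans (min_le_left _ _)
  have hr1 : r ≤ 1 := (min_le_right _ _).trans (min_le_right _ _)
  obtain ⟨δ₁, hδ₁, H₁⟩ := exists_timeChange_close p q hr
  obtain ⟨δ₂, hδ₂, H₂⟩ := exists_timeChange_close (fun _ : Fin 1 => p 0) (fun _ => q 0) hr
  refine ⟨min δ₁ δ₂, lt_min hδ₁ hδ₂, fun ψ γ κ V h hψ hγ => ?_⟩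
  obtain ⟨l', hl', hψ⟩ := H₁ _ _ (hψ.trans_le (min_le_left _ _))
  obtain ⟨l'', hl, hγ⟩ := H₂ _ _ (hγ.trans_le (min_le_right _ _))
  let l : TimeChange (p 0) (q 0) := l'' 0
  have hlt : ∀ t : Icc (p 0) (q 0), |(l t : ℝ) - t| < r := fun t => hl 0 t
  have habs : ∀ t : Icc (p 0) (q 0), |(κ t : ℝ)| = |(κ₀ (l t) : ℝ)| := by
    intro t
    have h1 : |γ ⟨fun _ => t, _⟩ - γ₀ ⟨fun k => l'' k ⟨t, t.2⟩, _⟩| < r :=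
      hγ ⟨fun _ => t, fun _ => t.2.1, fun _ => t.2.2⟩
    rw [h.jumps_eq, h₀.jumps_eq] at h1
    have h2 := h1.trans_le hr1
    change |(|(κ (t : ℝ) : ℝ)| - |(κ₀ (l t : ℝ) : ℝ)|)| < 1 at h2
    have h3 : |(|κ t| - |κ₀ (l t)|)| < 1 := by exact_mod_cast h2
    have h4 : |κ t| = |κ₀ (l t)| := by
      rw [abs_lt] at h3
      omega
    exact_mod_cast h4
  have hpiece : ∀ s t : Icc (p 0) (q 0), κ₀ (l s) = κ₀ (l t) → κ s = κ t := by
    have hle : ∀ s t : Icc (p 0) (q 0), s ≤ t → κ₀ (l s) = κ₀ (l t) → κ s = κ t := by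
      intro s t hst hκ
      refine eq_of_forall_abs_eq h.monotone h.zero fun u hu => ?_
      rw [uIcc_of_le (show (s : ℝ) ≤ t from hst)] at hu
      let u' : Icc (p 0) (q 0) := ⟨u, s.2.1.trans hu.1, hu.2.trans t.2.2⟩
      have h1 : κ₀ (l u') = κ₀ (l s) := by
        apply le_antisymm
        · rw [hκ]
          exact h₀.monotone (l.monotone (show u' ≤ t from hu.2))
        · exact h₀.monotone (l.monotone (show s ≤ u' from hu.1))
      have h2 := habs u'
      rw [h1, ← habs s] at h2
      exact h2
    intro s t hκ
    rcases le_total s t with hst | hst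
    · exact hle s t hst hκ
    · exact (hle t s hst hκ.symm).symm
  refine ⟨l, fun t => (hlt t).trans_le (by linarith), hpiece, fun t ξ hξ => ?_⟩
  obtain ⟨s', hs', hball⟩ := hconst (l t) (l t).2
  let t' : Icc (p 0) (q 0) := l.symm ⟨s', hs'⟩
  have hlt' : l t' = ⟨s', hs'⟩ := l.apply_symm_apply _
  have hκs' : κ₀ s' = κ₀ (l t) := hball s' hs' (by simpa using hr₁)
  have hκt : κ t = κ t' := hpiece t t' (by rw [hlt', hκs'])
  let x : rect I := consPoint (hsub t' t'.2).1 ξ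
  have hx : x.1 ∈ Icc p q := hT.mem_Icc_iff.2 ⟨x.2, fun k => by
    refine Fin.cases ?_ (fun i => ?_) k
    · exact (hsub t' t'.2).2
    · exact hξ i⟩
  let y : Icc p q := applyChange l' ⟨x.1, hx⟩
  have hy := hT.mem_Icc_iff.1 y.2
  have h1 : |V (κ t') ξ - V₀ (κ₀ (y.1 0)) (tailPoint ⟨y.1, hy.1⟩)| < r := by
    have := hψ ⟨x.1, hx⟩
    change |ψ x - ψ₀ ⟨y.1, hy.1⟩| < r at this
    rw [h.apply_eq, h₀.apply_eq] at this
    exact this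
  have hy0 : |y.1 0 - t'| < r := hl' 0 t'
  have hκy : κ₀ (y.1 0) = κ₀ (l t) := by
    refine hball _ ⟨y.2.1 0, y.2.2 0⟩ ?_
    have h2 : |s' - t'| < r := by
      have := hlt t'
      rwa [hlt'] at this
    rw [abs_lt] at hy0 h2 ⊢
    constructor <;> linarith
  rw [hκy] at h1
  have hdist : dist ξ (tailPoint ⟨y.1, hy.1⟩) < r₂ := by
    rw [dist_comm, Subtype.dist_eq, dist_pi_lt_iff hr₂]
    exact fun k => (hl' k.succ _).trans_le hrr₂
  have h2 := hmod (κ₀ (l t)) (mem_Icc_of_abs_le h₀.monotone (hsub _ (l t).2).2) ξ _ hξ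
    (fun k => hy.2 k.succ) hdist
  rw [hκt]
  rw [abs_lt] at h1 h2 ⊢
  constructor <;> linarith

/-- Continuity of the extreme maximizers at a limit with a peak. -/
theorem StepData.dist_argmax_lt {ψ₀ : Space (rect I)} {γ₀ : Space (line (I 0))} {κ₀ : ℝ → ℤ}
    {V₀ : ℤ → tailRect I → ℝ} (h₀ : StepData ψ₀ γ₀ κ₀ V₀) (hI : ∀ k, IsClosedInterval (I k))
    (hV₀ : UniqueMaxima V₀) {x₀ y₀ : rect I} (hx₀ : IsSargmax ψ₀ x₀) (hy₀ : IsLargmax ψ₀ y₀)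
    {M : ℝ} {p q : Fin (m + 1) → ℝ} (hT : IsTruncation I M p q)
    (hpq : p ≤ q) (hq : ∀ᶠ s in 𝓝 (q 0), s ∈ I 0 → κ₀ s = κ₀ (q 0))
    (hxM : ∀ k, |x₀.1 k| ≤ M) (hyM : ∀ k, |y₀.1 k| ≤ M) {e : ℝ} (he : 0 < e) :
    ∃ δ : ℝ≥0∞, 0 < δ ∧ ∀ (ψ : Space (rect I)) (γ : Space (line (I 0))) (κ : ℝ → ℤ)
      (V : ℤ → tailRect I → ℝ), StepData ψ γ κ V →
      edist (ψ.restrict hT.subset) (ψ₀.restrict hT.subset) < δ →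
      edist (γ.restrict (Icc_subset_line hpq hT.subset))
        (γ₀.restrict (Icc_subset_line hpq hT.subset)) < δ →
      ∀ x y, IsSargmax ψ x → IsLargmax ψ y → (∀ k, |x.1 k| < M) → (∀ k, |y.1 k| < M) →
        dist x.1 x₀.1 < e ∧ dist y.1 y₀.1 < e := by
  have hmemIcc : ∀ t, t ∈ Icc (p 0) (q 0) ↔ t ∈ I 0 ∧ |t| ≤ M := fun t => by
    rw [← (hT 0).2, abs_le]; rfl
  obtain ⟨htail, j, M₀, hpeak⟩ := h₀.exists_isPeak hI hV₀ hx₀ hy₀ hT hxM hq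
  obtain ⟨η, hη, hgap⟩ := hpeak.exists_gap hI h₀.monotone h₀.continuous M (half_pos he)
  have he' : 0 < min (η / 3) (e / 2) := lt_min (by linarith) (half_pos he)
  obtain ⟨δ, hδ, H⟩ := h₀.exists_timeChange hI hT hpq hq he'
  refine ⟨δ, hδ, fun ψ γ κ V h hψ hγ => ?_⟩
  obtain ⟨l, hl, hpiece, hclose⟩ := H ψ γ κ V h hψ hγ
  let a₀ : Icc (p 0) (q 0) := ⟨x₀.1 0, (hmemIcc _).2 ⟨x₀.2 0 (mem_univ _), hxM 0⟩⟩
  let b₀ : Icc (p 0) (q 0) := ⟨y₀.1 0, (hmemIcc _).2 ⟨y₀.2 0 (mem_univ _), hyM 0⟩⟩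
  -- `[a, b)` is the interval on which `ψ` is nearly maximal.
  let a := l.symm a₀
  let b := l.symm b₀
  have hla : l a = a₀ := l.apply_symm_apply _
  have hlb : l b = b₀ := l.apply_symm_apply _
  have hab : a < b := l.symm.strictMono (show a₀ < b₀ from hpeak.lt)
  have hκa : κ₀ (l a) = j := by
    rw [hla]
    exact hpeak.index_eq _ ⟨le_rfl, hpeak.lt⟩
  have hindex : ∀ t, a ≤ t → t < b → κ t = κ a := fun t hat htb => hpiece t a (by
    rw [hκa]
    have h1 : a₀ ≤ l t := by rw [← hla]; exact l.monotone hat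
    have h2 : l t < b₀ := by rw [← hlb]; exact l.strictMono htb
    exact hpeak.index_eq _ ⟨h1, h2⟩)
  have hI0 : ∀ t : Icc (p 0) (q 0), (t : ℝ) ∈ I 0 := fun t => ((hmemIcc _).1 t.2).1
  -- The maximizers of `ψ` in the interior of the rectangle lie over `[a, b]`.
  have hmax : ∀ z, IsMaximizer ψ z → (∀ k, |z.1 k| < M) →
      (a : ℝ) ≤ z.1 0 ∧ z.1 0 ≤ b ∧ dist (tailPoint z) (tailPoint x₀) ≤ e / 2 ∧
        ∀ t, a ≤ t → t < b → IsMaximizer ψ (consPoint (hI0 t) (tailPoint z)) := by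
    intro z hz hzM
    obtain ⟨M₁, hM₁, -⟩ := id hz
    have hvalue : ∀ t (ξ : tailRect I), V (κ (t : Icc (p 0) (q 0))) ξ ≤ M₁ := fun t ξ => by
      have := hM₁.1 ⟨consPoint (hI0 t) ξ, rfl⟩
      rwa [h.apply_eq, consPoint_zero, tailPoint_consPoint] at this
    have hM₁' : M₀ - η / 3 < M₁ := by
      have h1 := (hclose a (tailPoint x₀) fun k => hxM k.succ).trans_le (min_le_left _ _)
      rw [hκa, hpeak.apply_eq, abs_lt] at h1
      linarith [hvalue a (tailPoint x₀)]
    let S : ℝ → Set (rect I) := fun c => {y | (a : ℝ) ≤ y.1 0} ∩ {y | y.1 0 ≤ b} ∩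
      {y | dist (tailPoint y) (tailPoint x₀) ≤ e / 2} ∩ {y | c ≤ V (κ a) (tailPoint y)}
    have hcoord : Continuous fun y : rect I => y.1 0 :=
      (continuous_apply 0).comp continuous_subtype_val
    have hScl : ∀ c, IsClosed (S c) := fun c =>
      (((isClosed_le continuous_const hcoord).inter (isClosed_le hcoord continuous_const)).inter
        (isClosed_le (continuous_tailPoint.dist continuous_const) continuous_const)).inter
        (isClosed_le continuous_const ((h.continuous _).comp continuous_tailPoint))
    have hS : ∀ c < M₁, M₁ - η / 3 < c → z ∈ S c := by
      intro c hc hc'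
      refine (hScl c).closure_subset (mem_closure_iff.2 fun U hU hzU => ?_)
      obtain ⟨U', hU', rfl⟩ := isOpen_induced_iff.1 hU
      have hO : IsOpen (U' ∩ {y : Fin (m + 1) → ℝ | ∀ k, |y k| < M}) := by
        refine hU'.inter ?_
        simp only [ofPred_forall]
        exact isOpen_iInter_of_finite fun k => isOpen_lt (continuous_apply k).abs continuous_const
      obtain ⟨_, ⟨w, rfl⟩, hw⟩ := (lt_isLUB_iff hM₁).1 hc
      obtain ⟨y, ⟨hyU, hyM⟩, hy⟩ := hz.mem_nearMaxSet.2 _ hO ⟨hzU, hzM⟩ c ⟨w, hw⟩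
      let t : Icc (p 0) (q 0) := ⟨y.1 0, (hmemIcc _).2 ⟨y.2 0 (mem_univ _), (hyM 0).le⟩⟩
      have hyt : ψ y = V (κ t) (tailPoint y) := h.apply_eq y
      have h1 := (hclose t (tailPoint y) fun k => (hyM k.succ).le).trans_le (min_le_left _ _)
      have h2 := (hmemIcc _).1 (l t).2
      have h3 := hgap (l t) h2.1 h2.2 (tailPoint y) (fun k => (hyM k.succ).le) (by
        rw [abs_lt] at h1
        linarith)
      have h4 := hpeak.mem_Icc _ h2.1 h3.1
      have hat : a ≤ t := by
        rw [← l.le_iff_le, hla]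
        exact h4.1
      have htb : t ≤ b := by
        rw [← l.le_iff_le, hlb]
        exact h4.2
      have hκt : κ t = κ a := hpiece t a (by rw [h3.1, hκa])
      refine ⟨y, hyU, ⟨⟨hat, htb⟩, h3.2.le⟩, ?_⟩
      rw [mem_ofPred_eq, ← hκt, ← hyt]
      exact hy.le
    have hVz : V (κ a) (tailPoint z) = M₁ := by
      refine le_antisymm (hvalue a _) (le_of_forall_lt_imp_le_of_dense fun c hc => ?_)
      have hc' : max c (M₁ - η / 6) < M₁ := max_lt hc (by linarith)
      have := (hS _ hc' (lt_of_lt_of_le (by linarith) (le_max_right _ _))).2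
      exact (le_max_left _ _).trans this
    obtain ⟨⟨⟨h1, h2⟩, h3⟩, -⟩ := hS (M₁ - η / 6) (by linarith) (by linarith)
    refine ⟨h1, h2, h3, fun t hat htb => isMaximizer_of_isLUB ?_⟩
    rwa [h.apply_eq, consPoint_zero, tailPoint_consPoint, hindex t hat htb, hVz]
  have hfinal : ∀ z w : rect I, |z.1 0 - w.1 0| < e / 2 →
      dist (tailPoint z) (tailPoint w) ≤ e / 2 → dist z.1 w.1 < e := by
    intro z w h0 hd
    rw [dist_pi_lt_iff he]
    refine Fin.cases (h0.trans (half_lt_self he)) fun k => ?_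
    exact ((dist_le_pi_dist (tailPoint z).1 (tailPoint w).1 k).trans hd).trans_lt (half_lt_self he)
  intro x y hx hy hx' hy'
  constructor
  · obtain ⟨h1, -, h3, h4⟩ := hmax x hx.1 hx'
    have h5 : x.1 0 ≤ a := hx.2 _ (h4 a le_rfl hab) 0 fun k hk => absurd hk (Fin.not_lt_zero k)
    refine hfinal x x₀ ?_ h3
    have h6 := (hl a).trans_le (min_le_right _ _)
    rw [hla] at h6
    rw [le_antisymm h5 h1, abs_sub_comm]
    exact h6
  · obtain ⟨-, h2, h3, h4⟩ := hmax y hy.1 hy'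
    have h5 : (b : ℝ) ≤ y.1 0 := by
      refine le_of_forall_lt_imp_le_of_dense fun c hc => ?_
      have hmax' : max c a < (b : ℝ) := max_lt hc hab
      have := hy.2 _ (h4 ⟨max c a, a.2.1.trans (le_max_right _ _), hmax'.le.trans b.2.2⟩
        (le_max_right c (a : ℝ)) hmax') 0 fun k hk => absurd hk (Fin.not_lt_zero k)
      exact (le_max_left _ _).trans this
    rw [htail] at h3
    refine hfinal y y₀ ?_ h3
    have h6 := (hl b).trans_le (min_le_right _ _)
    rw [hlb] at h6
    rw [le_antisymm h2 h5, abs_sub_comm]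
    exact h6

end Stability

/-! ### Convergence in distribution -/

instance hasOuterApproxClosed_jointSpace {m : ℕ} (p q : Fin (m + 1) → ℝ) :
    HasOuterApproxClosed (JointSpace p q) :=
  inferInstanceAs (HasOuterApproxClosed
    (Space (Icc p q) × Space (Icc (fun _ : Fin 1 => p 0) (fun _ : Fin 1 => q 0))))

theorem exists_measure_lt_norm_le {Ω E : Type*} [MeasurableSpace Ω] {P : Measure Ω}
    [IsFiniteMeasure P] [NormedAddCommGroup E] [MeasurableSpace E] [OpensMeasurableSpace E]
    {X : Ω → E} (hX : AEMeasurable X P) {e : ℝ≥0∞} (he : 0 < e) :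
    ∃ M : ℝ, P {ω | M < ‖X ω‖} ≤ e := by
  have h := tendsto_measure_iInter_atTop (μ := P) (s := fun n : ℕ => {ω | (n : ℝ) < ‖X ω‖})
    (fun n => nullMeasurableSet_lt aemeasurable_const hX.norm)
    (fun a b hab ω hω => show (a : ℝ) < ‖X ω‖ from (Nat.cast_le.2 hab).trans_lt hω) ⟨0, measure_ne_top _ _⟩
  have h0 : ⋂ n : ℕ, {ω | (n : ℝ) < ‖X ω‖} = ∅ := by
    rw [eq_empty_iff_forall_notMem]
    intro ω hω
    obtain ⟨n, hn⟩ := exists_nat_ge ‖X ω‖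
    exact absurd (mem_iInter.1 hω n) (not_lt.2 hn)
  rw [h0, measure_empty] at h
  obtain ⟨n, hn⟩ := (h.eventually (gt_mem_nhds he)).exists
  exact ⟨n, hn.le⟩

/-- The restrictions to `[p, q]` of the pairs driven by a common step function, whose extreme
maximizers exist, have coordinates smaller than `M` in absolute value, and belong to `F`. -/
def argmaxRestrictions {m : ℕ} {I : Fin (m + 1) → Set ℝ} {p q : Fin (m + 1) → ℝ} (hpq : p ≤ q)
    (hsub : Icc p q ⊆ rect I) (M : ℝ) (F : Set ((Fin (m + 1) → ℝ) × (Fin (m + 1) → ℝ))) :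
    Set (JointSpace p q) :=
  {f | ∃ (ψ : Space (rect I)) (γ : Space (line (I 0))) (x y : rect I),
    (∃ κ V, StepData ψ γ κ V) ∧ IsSargmax ψ x ∧ IsLargmax ψ y ∧
    (∀ k, |x.1 k| < M) ∧ (∀ k, |y.1 k| < M) ∧ (x.1, y.1) ∈ F ∧ f = restrictPair hpq hsub ψ γ}

/-- Adherent points of `argmaxRestrictions` have their extreme maximizers in `F`, if they are
restrictions of functions at which these maximizers depend continuously on the restriction. -/
theorem StepData.mem_of_mem_closure {m : ℕ} {I : Fin (m + 1) → Set ℝ} {ψ₀ : Space (rect I)}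
    {γ₀ : Space (line (I 0))} {κ₀ : ℝ → ℤ} {V₀ : ℤ → tailRect I → ℝ} (h₀ : StepData ψ₀ γ₀ κ₀ V₀)
    (hI : ∀ k, IsClosedInterval (I k)) (hV₀ : UniqueMaxima V₀) {x₀ y₀ : rect I}
    (hx₀ : IsSargmax ψ₀ x₀) (hy₀ : IsLargmax ψ₀ y₀) {M : ℝ} {p q : Fin (m + 1) → ℝ}
    (hT : IsTruncation I M p q) (hpq : p ≤ q)
    (hq : ∀ᶠ s in 𝓝 (q 0), s ∈ I 0 → κ₀ s = κ₀ (q 0))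
    (hxM : ∀ k, |x₀.1 k| ≤ M) (hyM : ∀ k, |y₀.1 k| ≤ M)
    {F : Set ((Fin (m + 1) → ℝ) × (Fin (m + 1) → ℝ))} (hF : IsClosed F)
    (hmem : restrictPair hpq hT.subset ψ₀ γ₀ ∈ closure (argmaxRestrictions hpq hT.subset M F)) :
    (x₀.1, y₀.1) ∈ F := by
  by_contra hnot
  obtain ⟨e, he, hball⟩ := Metric.isOpen_iff.1 hF.isOpen_compl _ hnot
  obtain ⟨δ, hδ, H⟩ := h₀.dist_argmax_lt hI hV₀ hx₀ hy₀ hT hpq hq hxM hyM he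
  have hU : IsOpen {f : JointSpace p q | edist f.1 (ψ₀.restrict hT.subset) < δ ∧
      edist f.2 (γ₀.restrict (Icc_subset_line hpq hT.subset)) < δ} :=
    (Metric.isOpen_eball.preimage continuous_fst).inter
      (Metric.isOpen_eball.preimage continuous_snd)
  obtain ⟨_, hfU, ψ, γ, x, y, ⟨κ, V, h⟩, hx, hy, hx', hy', hxyF, rfl⟩ :=
    mem_closure_iff.1 hmem _ hU ⟨by rw [restrictPair, edist_self]; exact hδ,
      by rw [restrictPair, edist_self]; exact hδ⟩
  obtain ⟨h1, h2⟩ := H ψ γ κ V h hfU.1 hfU.2 x y hx hy hx' hy'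
  exact hball (show dist (x.1, y.1) (x₀.1, y₀.1) < e from max_lt h1 h2) hxyF

end Skorohod

open Skorohod

theorem theorem3p2 {m : ℕ} (I : Fin (m + 1) → Set ℝ)
    (hI : ∀ k, Skorohod.IsClosedInterval (I k)) (h0 : (0 : ℝ) ∈ interior (I 0))
    {Ω : Type*} [MeasurableSpace Ω] (P : Measure Ω) [IsProbabilityMeasure P]
    -- the processes `(Ψ_n, Γ_n)` and the limit `(Ψ₀, Γ₀)`
    (Ψ : ℕ → Ω → Skorohod.JumpSpace I) (Γ : ℕ → Ω → Skorohod.PureJumpSpace (I 0))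
    (Ψ₀ : Ω → Skorohod.JumpSpace I) (Γ₀ : Ω → Skorohod.PureJumpSpace (I 0))
    -- `Ψ_n` has the representation as a jump function for the jumps of `Γ_n`
    (hrep : ∀ n, ∀ᵐ ω ∂P, ∃ a V,
      Skorohod.HasJumps (Γ n ω).1 a ∧ Skorohod.HasRepresentation (Ψ n ω).1 a V)
    -- so does the limit, with the unique-maximum condition
    (hrep₀ : ∀ᵐ ω ∂P, ∃ a V, Skorohod.HasJumps (Γ₀ ω).1 a ∧
      Skorohod.HasRepresentation (Ψ₀ ω).1 a V ∧ Skorohod.UniqueMaxima V)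
    -- `Γ₀` has no fixed time of discontinuity
    (hfix : ∀ t : Skorohod.line (I 0), ∀ᵐ ω ∂P, ContinuousAt (Γ₀ ω).1 t)
    -- the functionals are well defined
    (hdef₀ : ∀ᵐ ω ∂P, Skorohod.ArgmaxDefined (Ψ₀ ω).1)
    (hdef : ∀ n, ∀ᵐ ω ∂P, Skorohod.ArgmaxDefined (Ψ n ω).1)
    -- joint weak convergence on all compact subrectangles
    (hconv : ∀ (p q : Fin (m + 1) → ℝ) (hpq : ∀ k, p k < q k)
      (hsub : Icc p q ⊆ Skorohod.rect I),
      TendstoInDistribution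
        (fun n ω => Skorohod.restrictPair (fun k => (hpq k).le) hsub (Ψ n ω).1 (Γ n ω).1) atTop
        (fun ω => Skorohod.restrictPair (fun k => (hpq k).le) hsub (Ψ₀ ω).1 (Γ₀ ω).1)
        (fun _ => P) P)
    -- tightness of the maximizers
    (htight : Skorohod.BoundedInProbability P
      (fun n ω => (Skorohod.sargmax (Ψ n ω).1, Skorohod.largmax (Ψ n ω).1))) :
    TendstoInDistribution
      (fun n ω => (Skorohod.sargmax (Ψ n ω).1, Skorohod.largmax (Ψ n ω).1)) atTop
      (fun ω => (Skorohod.sargmax (Ψ₀ ω).1, Skorohod.largmax (Ψ₀ ω).1))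
      (fun _ => P) P := by
  have hstep : ∀ n, ∀ᵐ ω ∂P, ∃ κ V, StepData (Ψ n ω).1 (Γ n ω).1 κ V := fun n => by
    filter_upwards [hrep n] with ω ⟨a, V, hγ, hψ⟩
    obtain ⟨κ, hκ⟩ := hψ.exists_stepData hγ
    exact ⟨κ, V, hκ⟩
  have hstep₀ : ∀ᵐ ω ∂P, ∃ κ V, StepData (Ψ₀ ω).1 (Γ₀ ω).1 κ V ∧ UniqueMaxima V := by
    filter_upwards [hrep₀] with ω ⟨a, V, hγ, hψ, hV⟩
    obtain ⟨κ, hκ⟩ := hψ.exists_stepData hγ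
    exact ⟨κ, V, hκ, hV⟩
  have hmeas : ∀ n, AEMeasurable (fun ω => (sargmax (Ψ n ω).1, largmax (Ψ n ω).1)) P := fun n =>
    aemeasurable_sargmax_largmax hI (hstep n) (hdef n) fun p q hpq hsub =>
      (hconv p q hpq hsub).forall_aemeasurable n
  have hmeas₀ : AEMeasurable (fun ω => (sargmax (Ψ₀ ω).1, largmax (Ψ₀ ω).1)) P :=
    aemeasurable_sargmax_largmax hI (hstep₀.mono fun ω ⟨κ, V, h, _⟩ => ⟨κ, V, h⟩) hdef₀
      fun p q hpq hsub => (hconv p q hpq hsub).aemeasurable_limit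
  refine ⟨hmeas, hmeas₀, tendsto_of_forall_isClosed_limsup_le' fun F hF => ?_⟩
  change limsup (fun n => P.map (fun ω => (sargmax (Ψ n ω).1, largmax (Ψ n ω).1)) F) atTop ≤
    P.map (fun ω => (sargmax (Ψ₀ ω).1, largmax (Ψ₀ ω).1)) F
  refine ENNReal.le_of_forall_pos_le_add fun ε hε _ => ?_
  have he : (0 : ℝ≥0∞) < ε / 2 := ENNReal.half_pos (by simpa using hε.ne')
  set e : ℝ≥0∞ := ε / 2 with hedef
  obtain ⟨M₁, hM₁⟩ := htight e he
  obtain ⟨M₂, hM₂⟩ := exists_measure_lt_norm_le hmeas₀ he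
  obtain ⟨M, ⟨p, q, hT⟩, hMM₁, hMM₂⟩ := ((exists_isTruncation hI).and
    ((eventually_gt_atTop M₁).and (eventually_gt_atTop M₂))).exists
  have hpq : ∀ k, p k < q k := fun k => (hT k).1
  have hpq' : p ≤ q := fun k => (hpq k).le
  have hX := hconv p q hpq hT.subset
  have hG : IsClosed (closure (argmaxRestrictions hpq' hT.subset M F)) := isClosed_closure
  have hlt : ∀ (u v : Fin (m + 1) → ℝ) (M' : ℝ), M' < M → ¬M' < ‖(u, v)‖ →
      (∀ k, |u k| < M) ∧ ∀ k, |v k| < M := by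
    intro u v M' hM' h
    have h' := (not_lt.1 h).trans_lt hM'
    rw [Prod.norm_def, max_lt_iff] at h'
    exact ⟨fun k => (norm_le_pi_norm u k).trans_lt h'.1,
      fun k => (norm_le_pi_norm v k).trans_lt h'.2⟩
  have hn : ∀ n, P.map (fun ω => (sargmax (Ψ n ω).1, largmax (Ψ n ω).1)) F ≤
      P.map (fun ω => restrictPair hpq' hT.subset (Ψ n ω).1 (Γ n ω).1)
        (closure (argmaxRestrictions hpq' hT.subset M F)) + e := by
    intro n
    rw [Measure.map_apply_of_aemeasurable (hmeas n) hF.measurableSet,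
      Measure.map_apply_of_aemeasurable (hX.forall_aemeasurable n) hG.measurableSet]
    refine le_trans ?_ ((measure_union_le _ _).trans (add_le_add le_rfl (hM₁ n)))
    refine measure_mono_ae ?_
    filter_upwards [hstep n, hdef n] with ω hω ⟨⟨x, hx⟩, y, hy⟩ hmem
    by_cases hlarge : M₁ < ‖(sargmax (Ψ n ω).1, largmax (Ψ n ω).1)‖
    · exact Or.inr hlarge
    · replace hmem : (sargmax (Ψ n ω).1, largmax (Ψ n ω).1) ∈ F := hmem
      have hbd := hlt _ _ M₁ hMM₁ hlarge
      rw [hx.sargmax_eq, hy.largmax_eq] at hmem hbd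
      exact Or.inl (subset_closure ⟨_, _, x, y, hω, hx, hy, hbd.1, hbd.2, hmem, rfl⟩)
  have hlim : P.map (fun ω => restrictPair hpq' hT.subset (Ψ₀ ω).1 (Γ₀ ω).1)
        (closure (argmaxRestrictions hpq' hT.subset M F)) ≤
      P.map (fun ω => (sargmax (Ψ₀ ω).1, largmax (Ψ₀ ω).1)) F + e := by
    rw [Measure.map_apply_of_aemeasurable hmeas₀ hF.measurableSet,
      Measure.map_apply_of_aemeasurable hX.aemeasurable_limit hG.measurableSet]
    refine le_trans ?_ ((measure_union_le _ _).trans (add_le_add le_rfl hM₂))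
    refine measure_mono_ae ?_
    have hqI : q 0 ∈ I 0 := ((Set.ext_iff.1 (hT 0).2 _).2 (right_mem_Icc.2 (hT 0).1.le)).1
    filter_upwards [hstep₀, hdef₀, hfix ⟨fun _ => q 0, fun _ _ => hqI⟩] with ω ⟨κ, V, h, hV⟩
      ⟨⟨x, hx⟩, y, hy⟩ hcont hmem
    by_cases hlarge : M₂ < ‖(sargmax (Ψ₀ ω).1, largmax (Ψ₀ ω).1)‖
    · exact Or.inr hlarge
    · have hbd := hlt _ _ M₂ hMM₂ hlarge
      rw [hx.sargmax_eq, hy.largmax_eq] at hbd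
      refine Or.inl ?_
      change (sargmax (Ψ₀ ω).1, largmax (Ψ₀ ω).1) ∈ F
      rw [hx.sargmax_eq, hy.largmax_eq]
      exact h.mem_of_mem_closure hI hV hx hy hT hpq'
        (h.eventually_eq_of_continuousAt (hI 0).ordConnected hqI hcont)
        (fun k => (hbd.1 k).le) (fun k => (hbd.2 k).le) hF hmem
  calc limsup (fun n => P.map (fun ω => (sargmax (Ψ n ω).1, largmax (Ψ n ω).1)) F) atTop
      ≤ limsup (fun n => P.map (fun ω => restrictPair hpq' hT.subset (Ψ n ω).1 (Γ n ω).1)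
        (closure (argmaxRestrictions hpq' hT.subset M F)) + e) atTop :=
        limsup_le_limsup (Eventually.of_forall hn)
    _ = limsup (fun n => P.map (fun ω => restrictPair hpq' hT.subset (Ψ n ω).1 (Γ n ω).1)
        (closure (argmaxRestrictions hpq' hT.subset M F))) atTop + e :=
        limsup_add_const _ _ _ (by isBoundedDefault) (by isBoundedDefault)
    _ ≤ P.map (fun ω => restrictPair hpq' hT.subset (Ψ₀ ω).1 (Γ₀ ω).1)
        (closure (argmaxRestrictions hpq' hT.subset M F)) + e :=
        add_le_add (ProbabilityMeasure.limsup_measure_closed_le_of_tendsto hX.tendsto hG) le_rfl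
    _ ≤ P.map (fun ω => (sargmax (Ψ₀ ω).1, largmax (Ψ₀ ω).1)) F + e + e :=
        add_le_add hlim le_rfl
    _ = P.map (fun ω => (sargmax (Ψ₀ ω).1, largmax (Ψ₀ ω).1)) F + ε := by
        rw [add_assoc, ENNReal.add_halves]
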